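/- Let $(\Omega,\mathcal F,\mathbb P)$ be a complete probability space carrying a real-valued Lévy process $X=(X_t)_{t\ge 0}$ (started at $0$ under $\mathbb P$), let $\mathbb F$ be the ($\mathbb P$-completed) filtration generated by $X$, and let $\mathbb P^x$, $\mathbb E^x$ denote the law and expectation under which $X$ is started at $x\in\mathbb R$ (i.e. $X$ is replaced by $x+X$). Let $\theta=\inf\{t\ge 0: X_t\le 0\}$ be the default time ($\inf\emptyset=\infty$), let $r>0$ be the interest rate, with $e^{-r\infty}=0$, and let $\mathcal S$ be the set of all $\mathbb F$-stopping times $\tau$ (with values in $[0,\infty]$) such that $\tau\le\theta$ almost surely under $\mathbb P^x$. For $p,\alpha,\kappa,a,K\in\mathbb R$ define the buyer's value of the perpetual vanilla credit default swap with premium $p$ and default payment $\alpha$, $$C(x;p,\alpha)=\mathbb E^x\Big[-\int_0^\theta e^{-rt}p\,dt+\alpha e^{-r\theta}\Big],$$ and the price of the perpetual American default swaption, knocked out at default (a payer swaption if $\kappa,a\ge 0$, a receiver swaption if $\kappa,a\le 0$), $$v(x;\kappa,a,K)=\sup_{\tau\in\mathcal S}\mathbb E^x\Big[e^{-r\tau}\big(C(X_\tau;\kappa,a)-K\big)^+1_{\{\tau<\theta\}}\Big].$$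 For constants $p,\hat p,\alpha,\hat\alpha,\gamma\ge 0$ define the buyer's value of the perpetual American callable step-up/down default swap, $$V(x;p,\hat p,\alpha,\hat\alpha,\gamma)=\sup_{\tau\in\mathcal S}\mathbb E^x\Big[-\int_0^\tau e^{-rt}p\,dt+1_{\{\tau<\infty\}}\Big(-\int_\tau^\theta e^{-rt}\hat p\,dt-e^{-r\tau}\gamma 1_{\{\tau<\theta\}}+e^{-r\theta}\big(\hat\alpha 1_{\{\tau<\theta\}}+\alpha 1_{\{\tau=\theta\}}\big)\Big)\Big].$$ Put $\tilde p=p-\hat p$ and $\tilde\alpha=\alpha-\hat\alpha$. Then for every $x\in\mathbb R$ all of the random variables appearing in the definitions of $C$ and of the two suprema $V(x;p,\hat p,\alpha,\hat\alpha,\gamma)$, $v(x;-\tilde p,-\tilde\alpha,\gamma)$ are integrable, both suprema are finite, and $$V(x;p,\hat p,\alpha,\hat\alpha,\gamma)=C(x;p,\alpha)+v(x;-\tilde p,-\tilde\alpha,\gamma).$$ -/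

import Mathlib

open MeasureTheory ProbabilityTheory Filter Topology
open scoped NNReal

noncomputable section

namespace DefaultSwap

variable {Ω : Type*} {m : MeasurableSpace Ω}

/-- `X` is a (real-valued) Lévy process under `P`, started at `0`. -/
structure IsLevyProcess (X : ℝ≥0 → Ω → ℝ) (P : Measure Ω) : Prop where
  measurable : ∀ t, Measurable (X t)
  start_zero : ∀ᵐ ω ∂P, X 0 ω = 0
  indep_increments : HasIndepIncrements X P
  stationary_increments : ∀ s t : ℝ≥0, s ≤ t →
    IdentDistrib (fun ω ↦ X t ω - X s ω) (X (t - s)) P P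
  cadlag : ∀ᵐ ω ∂P, ∀ t : ℝ≥0,
    ContinuousWithinAt (fun s ↦ X s ω) (Set.Ici t) t ∧
      ∃ l : ℝ, Tendsto (fun s ↦ X s ω) (𝓝[<] t) (𝓝 l)

/-- The filtration generated by `X`, completed by the `P`-null sets: `F t` consists of the sets
that agree `P`-almost surely with a set of `σ(X s : s ≤ t)`. It is also the filtration generated
by the shifted process `x + X`. -/
def generatedFiltration (P : Measure Ω) [P.IsComplete] (X : ℝ≥0 → Ω → ℝ)
    (hX : ∀ t, Measurable (X t)) : Filtration ℝ≥0 m where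
  seq t := eventuallyMeasurableSpace
    (Filtration.natural X (fun s ↦ (hX s).stronglyMeasurable) t) (ae P)
  mono' := by
    rintro s t hst A ⟨B, hB, hAB⟩
    exact ⟨B, (Filtration.natural X (fun s ↦ (hX s).stronglyMeasurable)).mono hst B hB, hAB⟩
  le' := by
    rintro t A ⟨B, hB, hAB⟩
    have hB' : MeasurableSet B :=
      (Filtration.natural X (fun s ↦ (hX s).stronglyMeasurable)).le t B hB
    exact (hB'.nullMeasurableSet.congr hAB.symm).measurable_of_complete

/-- The default time of the process `x + X`: the first time at which it is `≤ 0`, and `⊤` if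
there is none. -/
def defaultTime (X : ℝ≥0 → Ω → ℝ) (x : ℝ) : Ω → WithTop ℝ≥0 :=
  hittingAfter (fun t ω ↦ x + X t ω) (Set.Iic 0) 0

/-- The discount factor `exp (-r t)`, with value `0` at `t = ∞` (as `r > 0`). -/
def discount (r : ℝ) : WithTop ℝ≥0 → ℝ
  | ⊤ => 0
  | (t : ℝ≥0) => Real.exp (-r * t)

/-- The discounted premium leg `∫ exp (-r u) c du` over `s ≤ u < t`, for `s`, `t` in `[0, ∞]`. -/
def premiumLeg (r c : ℝ) (s t : WithTop ℝ≥0) : ℝ :=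
  ∫ u in {u : ℝ | 0 ≤ u ∧ s ≤ (u.toNNReal : WithTop ℝ≥0) ∧ (u.toNNReal : WithTop ℝ≥0) < t},
    Real.exp (-r * u) * c

/-- The discounted cash flow to the buyer of a perpetual credit default swap with premium `p` and
default payment `α`, when the underlying process is `x + X`. -/
def cdsPayoff (X : ℝ≥0 → Ω → ℝ) (r x p α : ℝ) (ω : Ω) : ℝ :=
  -premiumLeg r p 0 (defaultTime X x ω) + α * discount r (defaultTime X x ω)

/-- The value `C(x; p, α)` of the perpetual credit default swap to its buyer. -/
def cdsValue (P : Measure Ω) (X : ℝ≥0 → Ω → ℝ) (r x p α : ℝ) : ℝ :=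
  ∫ ω, cdsPayoff X r x p α ω ∂P

/-- The stopping times of `F` that are almost surely at most the default time of `x + X`. -/
def exerciseTimes (P : Measure Ω) (X : ℝ≥0 → Ω → ℝ) (F : Filtration ℝ≥0 m) (x : ℝ) :
    Set (Ω → WithTop ℝ≥0) :=
  {τ | IsStoppingTime F τ ∧ ∀ᵐ ω ∂P, τ ω ≤ defaultTime X x ω}

open scoped Classical in
/-- The discounted payoff `exp (-r τ) (C(X_τ; κ, a) - K)⁺ 1{τ < θ}` of the swaption exercised at
`τ`, when the underlying process is `x + X`. -/
def swaptionPayoff (P : Measure Ω) (X : ℝ≥0 → Ω → ℝ) (r x κ a K : ℝ)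
    (τ : Ω → WithTop ℝ≥0) (ω : Ω) : ℝ :=
  if τ ω < defaultTime X x ω then
    discount r (τ ω) *
      max (cdsValue P X r (stoppedValue (fun t ω ↦ x + X t ω) τ ω) κ a - K) 0
  else 0

/-- The expected discounted swaption payoffs over all admissible exercise times. -/
def swaptionExpectations (P : Measure Ω) (X : ℝ≥0 → Ω → ℝ) (F : Filtration ℝ≥0 m)
    (r x κ a K : ℝ) : Set ℝ :=
  (fun τ ↦ ∫ ω, swaptionPayoff P X r x κ a K τ ω ∂P) '' exerciseTimes P X F x

/-- The price `v(x; κ, a, K)` of the perpetual American default swaption. -/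
def swaptionValue (P : Measure Ω) (X : ℝ≥0 → Ω → ℝ) (F : Filtration ℝ≥0 m)
    (r x κ a K : ℝ) : ℝ :=
  sSup (swaptionExpectations P X F r x κ a K)

open scoped Classical in
/-- The discounted cash flow to the buyer of the callable default swap who switches at `τ` from
premium `p` and default payment `α` to premium `p'` and default payment `α'`, for the fee `γ`,
when the underlying process is `x + X`. -/
def callablePayoff (X : ℝ≥0 → Ω → ℝ) (r x p p' α α' γ : ℝ)
    (τ : Ω → WithTop ℝ≥0) (ω : Ω) : ℝ :=
  -premiumLeg r p 0 (τ ω) +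
    if τ ω < ⊤ then
      -premiumLeg r p' (τ ω) (defaultTime X x ω)
        - discount r (τ ω) * γ * (if τ ω < defaultTime X x ω then 1 else 0)
        + discount r (defaultTime X x ω) *
          (α' * (if τ ω < defaultTime X x ω then 1 else 0)
            + α * (if τ ω = defaultTime X x ω then 1 else 0))
    else 0

/-- The expected cash flows of the callable default swap over all admissible exercise times. -/
def callableExpectations (P : Measure Ω) (X : ℝ≥0 → Ω → ℝ) (F : Filtration ℝ≥0 m)
    (r x p p' α α' γ : ℝ) : Set ℝ :=
  (fun τ ↦ ∫ ω, callablePayoff X r x p p' α α' γ τ ω ∂P) '' exerciseTimes P X F x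

/-- The buyer's value `V(x; p, p', α, α', γ)` of the perpetual American callable step-up/down
default swap. -/
def callableValue (P : Measure Ω) (X : ℝ≥0 → Ω → ℝ) (F : Filtration ℝ≥0 m)
    (r x p p' α α' γ : ℝ) : ℝ :=
  sSup (callableExpectations P X F r x p p' α α' γ)

end DefaultSwap

end

/-! Integrating the premium legs leaves only discount factors (`premiumLeg_eq`). For `τ ≤ θ` the
callable payoff is the payoff of the never-switched swap plus, on `{τ < θ}`, a linear combination of
`e^{-rτ}` and `e^{-rθ}` (`callablePayoff_eq`). By the strong Markov property `e^{-rθ}` may be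
replaced there, under the expectation, by `e^{-rτ} D(X_τ)`, where `D(y) = E^y[e^{-rθ}]`. Since `C(y;
κ, a) = -κ/r + (κ/r + a) D(y)`, the extra term becomes the expectation of `e^{-rτ} (C(X_τ; -p̃, -α̃)
- γ)` on `{τ < θ}` (`integral_callablePayoff`).

This is the swaption payoff without its positive part, which gives `≤` at once. For `≥`, replace `τ`
by `θ` wherever `C(X_τ; -p̃, -α̃) ≤ γ`: the new time is again admissible and its net payoff is the
positive part (`exists_integral_netPayoff_eq`).

The probabilistic work is to show that `θ` is a stopping time of the completed filtration and that
strong Markov applies. The passage time `ρ`, the limit of the first times below the levels `1 / (n +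
1)`, depends on the path at countably many times only, and `ρ ≤ θ`. If `ρ < θ`, the path jumps
upwards at `ρ`, a time announced by the level times. Strong Markov at the level times gives this
probability zero (`ae_hitTime_eq_passageTime`). -/

noncomputable section

namespace DefaultSwap

/-! ### Passage times of a path -/

/-- The infimum of the times `u i` at which the path `g` is below `1 / (n + 1)`. -/
def levelTime {ι : Type*} (u : ι → ℝ≥0) (g : ι → ℝ) (n : ℕ) : WithTop ℝ≥0 :=
  ⨅ i, if g i < 1 / ((n : ℝ) + 1) then (u i : WithTop ℝ≥0) else ⊤

/-- The limit of the level times `levelTime u g n` as the level decreases to `0`. -/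
def passageTime {ι : Type*} (u : ι → ℝ≥0) (g : ι → ℝ) : WithTop ℝ≥0 :=
  ⨆ n, levelTime u g n

lemma levelTime_lt_iff {ι : Type*} {u : ι → ℝ≥0} {g : ι → ℝ} {n : ℕ} {c : WithTop ℝ≥0} :
    levelTime u g n < c ↔ ∃ i, g i < 1 / ((n : ℝ) + 1) ∧ (u i : WithTop ℝ≥0) < c := by
  rw [levelTime, iInf_lt_iff]
  refine exists_congr fun i ↦ ?_
  split_ifs with h <;> simp only [h, true_and, false_and, not_top_lt]

lemma levelTime_le {ι : Type*} {u : ι → ℝ≥0} {g : ι → ℝ} {n : ℕ} {i : ι}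
    (h : g i < 1 / ((n : ℝ) + 1)) : levelTime u g n ≤ u i :=
  (iInf_le _ i).trans (by rw [if_pos h])

lemma levelTime_mono {ι : Type*} (u : ι → ℝ≥0) (g : ι → ℝ) : Monotone (levelTime u g) := by
  refine fun a b hab ↦ le_of_forall_gt fun c hc ↦ ?_
  obtain ⟨i, hi, hic⟩ := levelTime_lt_iff.1 hc
  exact levelTime_lt_iff.2 ⟨i, hi.trans_le (Nat.one_div_le_one_div hab), hic⟩

lemma levelTime_le_passageTime {ι : Type*} (u : ι → ℝ≥0) (g : ι → ℝ) (n : ℕ) :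
    levelTime u g n ≤ passageTime u g := le_iSup _ n

/-- A dense sequence of times. -/
def denseTime : ℕ → ℝ≥0 := TopologicalSpace.denseSeq ℝ≥0

lemma exists_denseTime_between {a b : ℝ≥0} (h : a < b) : ∃ k, a < denseTime k ∧ denseTime k < b := by
  obtain ⟨_, ⟨k, rfl⟩, hk⟩ := (TopologicalSpace.denseRange_denseSeq ℝ≥0).exists_between h
  exact ⟨k, hk.1, hk.2⟩

lemma exists_denseTime_between_withTop {a b : WithTop ℝ≥0} (h : a < b) :
    ∃ k, a < denseTime k ∧ denseTime k < b := by
  obtain ⟨c, hac, hcb⟩ := exists_between h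
  obtain ⟨d, had, hdc⟩ := exists_between hac
  lift c to ℝ≥0 using hcb.ne_top
  lift d to ℝ≥0 using hdc.ne_top
  obtain ⟨k, hk, hk'⟩ := exists_denseTime_between (WithTop.coe_lt_coe.1 hdc)
  exact ⟨k, had.trans (WithTop.coe_lt_coe.2 hk), (WithTop.coe_lt_coe.2 hk').trans hcb⟩

lemma passageTime_lt_iff {ι : Type*} {u : ι → ℝ≥0} {g : ι → ℝ} {c : WithTop ℝ≥0} :
    passageTime u g < c ↔
      ∃ k, (denseTime k : WithTop ℝ≥0) < c ∧ ∀ n, levelTime u g n < denseTime k := by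
  constructor
  · intro h
    obtain ⟨k, hk, hk'⟩ := exists_denseTime_between_withTop h
    exact ⟨k, hk', fun n ↦ (levelTime_le_passageTime u g n).trans_lt hk⟩
  · rintro ⟨k, hk, h⟩
    exact (iSup_le fun n ↦ (h n).le).trans_lt hk

/-- A right-continuous path below a level at time `t` stays below it for some time. -/
lemma exists_forall_lt_of_rightContinuous {f : ℝ≥0 → ℝ} {t : ℝ≥0}
    (hf : ContinuousWithinAt f (Set.Ici t) t) {c : ℝ} (h : f t < c) :
    ∃ s > t, ∀ u, t ≤ u → u < s → f u < c := by
  obtain ⟨s, hs, hs'⟩ := mem_nhdsGE_iff_exists_Ico_subset.1 (hf (Iio_mem_nhds h))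
  exact ⟨s, hs, fun u hu hu' ↦ hs' ⟨hu, hu'⟩⟩

lemma exists_forall_gt_of_rightContinuous {f : ℝ≥0 → ℝ} {t : ℝ≥0}
    (hf : ContinuousWithinAt f (Set.Ici t) t) {c : ℝ} (h : c < f t) :
    ∃ s > t, ∀ u, t ≤ u → u < s → c < f u := by
  obtain ⟨s, hs, hs'⟩ := mem_nhdsGE_iff_exists_Ico_subset.1 (hf (Ioi_mem_nhds h))
  exact ⟨s, hs, fun u hu hu' ↦ hs' ⟨hu, hu'⟩⟩

/-- The level is crossed strictly, so a right-continuous path stays below it on an interval to the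
right, which contains a dense time. -/
lemma levelTime_denseTime {f : ℝ≥0 → ℝ} (hf : ∀ t, ContinuousWithinAt f (Set.Ici t) t) (n : ℕ) :
    levelTime denseTime (fun k ↦ f (denseTime k)) n = levelTime id f n := by
  refine eq_of_forall_gt_iff fun c ↦ ?_
  rw [levelTime_lt_iff, levelTime_lt_iff]
  constructor
  · rintro ⟨k, hk⟩
    exact ⟨_, hk⟩
  · rintro ⟨t, ht, htc⟩
    obtain ⟨s, hs, hs'⟩ := exists_forall_lt_of_rightContinuous (hf t) ht
    obtain ⟨k, hk, hk'⟩ := exists_denseTime_between_withTop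
      (lt_min htc (WithTop.coe_lt_coe.2 hs))
    rw [lt_min_iff] at hk'
    exact ⟨k, hs' _ (WithTop.coe_lt_coe.1 hk).le (WithTop.coe_lt_coe.1 hk'.2), hk'.1⟩

lemma passageTime_denseTime {f : ℝ≥0 → ℝ} (hf : ∀ t, ContinuousWithinAt f (Set.Ici t) t) :
    passageTime denseTime (fun k ↦ f (denseTime k)) = passageTime id f := by
  simp only [passageTime, levelTime_denseTime hf]

/-- No time before `s` is below the level, so the infimum only sees times `s + t`. -/
lemma levelTime_shift {f : ℝ≥0 → ℝ} {s : ℝ≥0} {n : ℕ} (h : s ≤ levelTime id f n) :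
    levelTime id f n = s + levelTime id (fun t ↦ f (s + t)) n := by
  refine eq_of_forall_gt_iff fun c ↦ ?_
  constructor
  · intro hc
    obtain ⟨t, ht, htc⟩ := levelTime_lt_iff.1 hc
    have hst : s ≤ t := WithTop.coe_le_coe.1 (h.trans (levelTime_le ht))
    obtain ⟨u, rfl⟩ := exists_add_of_le hst
    refine lt_of_le_of_lt ?_ htc
    simp only [id, WithTop.coe_add]
    gcongr
    exact levelTime_le (u := id) (g := fun t ↦ f (s + t)) ht
  · intro hc
    obtain ⟨a, ha, hac⟩ : ∃ a : ℝ≥0,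
        levelTime id (fun t ↦ f (s + t)) n < a ∧ ((s + a : ℝ≥0) : WithTop ℝ≥0) ≤ c := by
      generalize levelTime id (fun t ↦ f (s + t)) n = z at hc
      cases z with
      | top => exact absurd hc (by rw [WithTop.add_top]; exact not_top_lt)
      | coe z =>
        cases c with
        | top => exact ⟨z + 1, WithTop.coe_lt_coe.2 (by simp), le_top⟩
        | coe c =>
          norm_cast at hc
          refine ⟨c - s, WithTop.coe_lt_coe.2 (lt_tsub_iff_left.2 hc), ?_⟩
          rw [add_tsub_cancel_of_le ((le_add_right le_rfl).trans hc.le)]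
    obtain ⟨t, ht, hta⟩ := levelTime_lt_iff.1 ha
    refine (levelTime_le (u := id) (g := f) ht).trans_lt (lt_of_lt_of_le ?_ hac)
    exact WithTop.coe_lt_coe.2 (by simpa using WithTop.coe_lt_coe.1 hta)

/-- The passage time of a path from the point reached at an earlier time. -/
lemma passageTime_shift {f : ℝ≥0 → ℝ} {s : ℝ≥0} (h : s < passageTime id f) :
    passageTime id f = s + passageTime id (fun t ↦ f (s + t)) := by
  obtain ⟨N, hN⟩ := lt_iSup_iff.1 h
  have key : ∀ n, N ≤ n → levelTime id f n = s + levelTime id (fun t ↦ f (s + t)) n :=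
    fun n hn ↦ levelTime_shift (hN.le.trans (levelTime_mono _ _ hn))
  refine le_antisymm (iSup_le fun n ↦ ?_) ?_
  · refine (levelTime_mono _ _ (le_max_right N n)).trans ?_
    rw [key _ (le_max_left N n)]
    gcongr
    exact levelTime_le_passageTime _ _ _
  · refine le_of_forall_ge fun c hc ↦ ?_
    cases c with
    | top => exact le_top
    | coe c =>
      have hsc : s ≤ c := WithTop.coe_le_coe.1 (h.le.trans hc)
      obtain ⟨a, rfl⟩ := exists_add_of_le hsc
      rw [WithTop.coe_add]
      gcongr
      refine iSup_le fun n ↦ (levelTime_mono _ _ (le_max_right N n)).trans ?_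
      have := (levelTime_le_passageTime id f (max N n)).trans hc
      rw [key _ (le_max_left N n)] at this
      generalize levelTime id (fun t ↦ f (s + t)) (max N n) = z at this ⊢
      cases z with
      | top => rw [WithTop.add_top, top_le_iff] at this; exact absurd this (WithTop.coe_ne_top)
      | coe z => norm_cast at this ⊢; simpa using this

/-- At a finite level time a right-continuous path is at most at the level. -/
lemma le_of_levelTime_eq {f : ℝ≥0 → ℝ} (hf : ∀ t, ContinuousWithinAt f (Set.Ici t) t) {n : ℕ}
    {t : ℝ≥0} (h : levelTime id f n = t) : f t ≤ 1 / ((n : ℝ) + 1) := by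
  by_contra! hlt
  obtain ⟨s, hs, hs'⟩ := exists_forall_gt_of_rightContinuous (hf t) hlt
  obtain ⟨i, hi, his⟩ := levelTime_lt_iff.1 (h.trans_lt (WithTop.coe_lt_coe.2 hs))
  have hti : t ≤ i := WithTop.coe_le_coe.1 (h.symm.le.trans (levelTime_le hi))
  exact absurd (hs' i hti (WithTop.coe_lt_coe.1 his)) (not_lt.2 hi.le)

/-! ### Comparison of the passage time with the first hitting time of the half-line -/

/-- The first time at which a path is nonpositive. -/
abbrev hitTime (f : ℝ≥0 → ℝ) : WithTop ℝ≥0 :=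
  hittingAfter (fun t (_ : Unit) ↦ f t) (Set.Iic 0) 0 ()

lemma passageTime_le_hitTime (f : ℝ≥0 → ℝ) : passageTime id f ≤ hitTime f := by
  refine iSup_le fun n ↦ le_of_forall_gt fun c hc ↦ ?_
  cases c with
  | top =>
    have := hc.ne
    rw [Ne, hittingAfter_eq_top_iff] at this
    push Not at this
    obtain ⟨j, -, hj⟩ := this
    exact levelTime_lt_iff.2 ⟨j, (Set.mem_Iic.1 hj).trans_lt (by positivity), WithTop.coe_lt_top _⟩
  | coe c =>
    obtain ⟨j, hj, hj'⟩ := hittingAfter_lt_iff.1 hc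
    exact levelTime_lt_iff.2 ⟨j, (Set.mem_Iic.1 hj').trans_lt (by positivity),
      WithTop.coe_lt_coe.2 hj.2⟩

/-- If a right-continuous path comes arbitrarily close to `(-∞, 0]` before reaching it, then it
has a jump at the passage time, which the increments after the level times detect. -/
lemma exists_increment_of_passageTime_lt_hitTime {f : ℝ≥0 → ℝ}
    (hf : ∀ t, ContinuousWithinAt f (Set.Ici t) t) (h : passageTime id f < hitTime f) :
    ∃ c : ℕ, ∃ d : ℝ≥0, 0 < d ∧ ∀ t, 0 < t → t < d → ∃ N, ∀ n ≥ N,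
      levelTime id f n < ⊤ ∧ 1 / ((c : ℝ) + 1) <
        f ((levelTime id f n).untopA + t) - f (levelTime id f n).untopA := by
  obtain ⟨T, hT⟩ := WithTop.ne_top_iff_exists.1 h.ne_top
  have hpos : ∀ t ≤ T, 0 < f t := by
    intro t ht
    have := notMem_of_lt_hittingAfter (lt_of_le_of_lt (WithTop.coe_le_coe.2 ht) (hT ▸ h))
      zero_le
    simpa using this
  -- Twice `1 / (c + 1)` still lies below `f T`: one half bounds the path at late level times, the
  -- other is left for the increment.
  obtain ⟨c, hc⟩ := exists_nat_one_div_lt (half_pos (hpos T le_rfl))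
  obtain ⟨S, hS, hS'⟩ := exists_forall_gt_of_rightContinuous (hf T)
    (show 2 * (1 / ((c : ℝ) + 1)) < f T by linarith)
  -- If level `n` were first reached at `T`, a lower level `m ≥ c` could not be reached before `S`,
  -- since `f` is above it on `[T, S)`. Its level time would then exceed the supremum `T`.
  have hlt : ∀ n, levelTime id f n < T := by
    intro n
    refine lt_of_le_of_ne (hT ▸ levelTime_le_passageTime id f n) fun hn ↦ ?_
    set m := max n c
    have : ((S : ℝ≥0) : WithTop ℝ≥0) ≤ levelTime id f m := by
      by_contra! hm
      obtain ⟨i, hi, hiS⟩ := levelTime_lt_iff.1 hm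
      rcases lt_or_ge i T with hiT | hiT
      · have := levelTime_le (u := id) (hi.trans_le (Nat.one_div_le_one_div (le_max_left n c)))
        rw [hn] at this
        exact absurd (WithTop.coe_le_coe.1 this) (not_le.2 hiT)
      · have h1 := hS' i hiT (WithTop.coe_lt_coe.1 hiS)
        have h2 : 1 / ((m : ℝ) + 1) ≤ 1 / ((c : ℝ) + 1) := Nat.one_div_le_one_div (le_max_right n c)
        have h3 : 0 < 1 / ((c : ℝ) + 1) := by positivity
        linarith
    exact absurd (WithTop.coe_le_coe.1 (this.trans (hT ▸ levelTime_le_passageTime id f m)))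
      (not_le.2 hS)
  refine ⟨c, S - T, tsub_pos_of_lt hS, fun t ht htS ↦ ?_⟩
  -- The level times increase to `T`, so adding the fixed `t > 0` eventually overshoots `T`, while
  -- staying below `S` because `t < S - T`.
  obtain ⟨N, hN⟩ : ∃ N, (T : WithTop ℝ≥0) < levelTime id f N + t := by
    by_cases hTt : T < t
    · exact ⟨0, (WithTop.coe_lt_coe.2 hTt).trans_le (le_add_left le_rfl)⟩
    · have : ((T - t : ℝ≥0) : WithTop ℝ≥0) < passageTime id f := by
        rw [← hT]
        exact WithTop.coe_lt_coe.2 (tsub_lt_self (ht.trans_le (not_lt.1 hTt)) ht)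
      obtain ⟨N, hN⟩ := lt_iSup_iff.1 this
      refine ⟨N, ?_⟩
      obtain ⟨a, ha⟩ := WithTop.ne_top_iff_exists.1 (hlt N).ne_top
      rw [← ha] at hN ⊢
      norm_cast at hN ⊢
      exact (tsub_lt_iff_right (not_lt.1 hTt)).1 hN
  refine ⟨max N c, fun n hn ↦ ?_⟩
  obtain ⟨a, ha⟩ := WithTop.ne_top_iff_exists.1 (hlt n).ne_top
  have haT : a < T := WithTop.coe_lt_coe.1 (ha ▸ hlt n)
  have h1 := le_of_levelTime_eq hf ha.symm
  have h2 : 1 / ((n : ℝ) + 1) ≤ 1 / ((c : ℝ) + 1) :=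
    Nat.one_div_le_one_div ((le_max_right N c).trans hn)
  have h3 : (T : WithTop ℝ≥0) < levelTime id f n + t :=
    hN.trans_le (by gcongr; exact levelTime_mono _ _ ((le_max_left N c).trans hn))
  rw [← ha] at h3 ⊢
  refine ⟨WithTop.coe_lt_top _, ?_⟩
  rw [show ((a : WithTop ℝ≥0)).untopA = a from rfl]
  have h4 : T < a + t := by exact_mod_cast h3
  have h5 := hS' (a + t) h4.le ((add_lt_add haT htS).trans_le (by
    rw [add_tsub_cancel_of_le hS.le]))
  linarith

section

/-! ### Discretisation of time -/

/-- The first time after `t` in the grid of mesh `1 / (k + 1)`. -/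
def gridTime (k : ℕ) (t : ℝ≥0) : ℝ≥0 := ((⌊((k : ℝ≥0) + 1) * t⌋₊ : ℝ≥0) + 1) / ((k : ℝ≥0) + 1)

lemma lt_gridTime (k : ℕ) (t : ℝ≥0) : t < gridTime k t := by
  rw [gridTime, lt_div_iff₀ (by positivity), mul_comm]
  exact Nat.lt_floor_add_one _

lemma gridTime_le (k : ℕ) (t : ℝ≥0) : gridTime k t ≤ t + 1 / ((k : ℝ≥0) + 1) := by
  rw [gridTime, add_div]
  gcongr
  rw [div_le_iff₀ (by positivity), mul_comm]
  exact Nat.floor_le zero_le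

lemma tendsto_gridTime (t : ℝ≥0) : Tendsto (fun k ↦ gridTime k t) atTop (𝓝[≥] t) := by
  refine tendsto_nhdsWithin_iff.2 ⟨?_, Eventually.of_forall fun k ↦ (lt_gridTime k t).le⟩
  refine tendsto_of_tendsto_of_tendsto_of_le_of_le tendsto_const_nhds ?_
    (fun k ↦ (lt_gridTime k t).le) (fun k ↦ gridTime_le k t)
  simpa using tendsto_const_nhds.add (tendsto_one_div_add_atTop_nhds_zero_nat (𝕜 := ℝ≥0))

lemma tendsto_comp_gridTime {f : ℝ≥0 → ℝ} {t : ℝ≥0} (hf : ContinuousWithinAt f (Set.Ici t) t) :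
    Tendsto (fun k ↦ f (gridTime k t)) atTop (𝓝 (f t)) :=
  hf.tendsto.comp (tendsto_gridTime t)

lemma measurable_gridTime (k : ℕ) : Measurable (gridTime k) := by
  have h : Measurable fun t : ℝ≥0 ↦ ⌊((k : ℝ≥0) + 1) * t⌋₊ :=
    Nat.measurable_floor.comp (measurable_id.const_mul _)
  unfold gridTime
  fun_prop

variable {Ω : Type*} {m : MeasurableSpace Ω}

/-- The grid time takes countably many values, so the map factors through `ℕ × Ω`. -/
lemma measurable_comp_gridTime {Y : ℝ≥0 → Ω → ℝ} (hm : ∀ t, Measurable (Y t)) (k : ℕ) :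
    Measurable fun p : ℝ≥0 × Ω ↦ Y (gridTime k p.1) p.2 := by
  have h : Measurable fun q : ℕ × Ω ↦ Y (((q.1 : ℝ≥0) + 1) / ((k : ℝ≥0) + 1)) q.2 :=
    measurable_from_prod_countable_right fun j ↦ hm (((j : ℝ≥0) + 1) / ((k : ℝ≥0) + 1))
  have hfl : Measurable fun p : ℝ≥0 × Ω ↦ (⌊((k : ℝ≥0) + 1) * p.1⌋₊, p.2) :=
    (Nat.measurable_floor.comp (measurable_fst.const_mul _)).prodMk measurable_snd
  have e : (fun p : ℝ≥0 × Ω ↦ Y (gridTime k p.1) p.2) =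
      (fun q : ℕ × Ω ↦ Y (((q.1 : ℝ≥0) + 1) / ((k : ℝ≥0) + 1)) q.2) ∘
        fun p : ℝ≥0 × Ω ↦ (⌊((k : ℝ≥0) + 1) * p.1⌋₊, p.2) := by
    ext p
    simp only [gridTime, Function.comp_apply]
  rw [e]
  exact h.comp hfl

/-- A right-continuous process with measurable marginals is jointly measurable. -/
lemma measurable_uncurry_of_rightContinuous {Y : ℝ≥0 → Ω → ℝ} (hm : ∀ t, Measurable (Y t))
    (hY : ∀ ω t, ContinuousWithinAt (fun s ↦ Y s ω) (Set.Ici t) t) :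
    Measurable fun p : ℝ≥0 × Ω ↦ Y p.1 p.2 :=
  measurable_of_tendsto_metrizable (fun k ↦ measurable_comp_gridTime hm k)
    (tendsto_pi_nhds.2 fun p ↦ tendsto_comp_gridTime (hY p.2 p.1))

/-- Freezing the path at time `i` reduces to the global statement while using only the marginals up
to `i`. The ambient σ-algebra is later taken to be `F i`. -/
lemma measurable_uncurry_Iic_of_rightContinuous {Y : ℝ≥0 → Ω → ℝ} {i : ℝ≥0}
    (hm : ∀ t ≤ i, Measurable (Y t))
    (hY : ∀ ω t, ContinuousWithinAt (fun s ↦ Y s ω) (Set.Ici t) t) :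
    Measurable fun p : Set.Iic i × Ω ↦ Y p.1 p.2 := by
  have h1 := measurable_uncurry_of_rightContinuous (Y := fun t ω ↦ Y (min t i) ω)
    (fun t ↦ hm _ (min_le_right _ _)) fun ω t ↦ ?_
  · have h2 : Measurable fun p : Set.Iic i × Ω ↦ ((p.1 : ℝ≥0), p.2) := by fun_prop
    have h3 : (fun p : Set.Iic i × Ω ↦ Y p.1 p.2) =
        (fun p ↦ Y (min p.1 i) p.2) ∘ fun p : Set.Iic i × Ω ↦ ((p.1 : ℝ≥0), p.2) := by
      ext p
      simp [min_eq_left (Set.mem_Iic.1 p.1.2)]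
    rw [h3]
    exact h1.comp h2
  · have h3 : ContinuousWithinAt (fun t : ℝ≥0 ↦ min t i) (Set.Ici t) t :=
      (continuous_id.min continuous_const).continuousWithinAt
    exact ContinuousWithinAt.comp (f := fun t : ℝ≥0 ↦ min t i) (t := Set.Ici (min t i))
      (hY ω (min t i)) h3
      fun s hs ↦ min_le_min_right i hs

/-- A right-continuous adapted process is strongly progressive. -/
lemma isStronglyProgressive_of_rightContinuous {F : Filtration ℝ≥0 m} {Y : ℝ≥0 → Ω → ℝ}
    (ha : Adapted F Y) (hY : ∀ ω t, ContinuousWithinAt (fun s ↦ Y s ω) (Set.Ici t) t) :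
    IsStronglyProgressive F Y :=
  IsProgressive.isStronglyProgressive fun i ↦
    @measurable_uncurry_Iic_of_rightContinuous Ω (F i) Y i
      (fun _ ht ↦ ha.measurable_le ht) hY

/-! ### The strong Markov property -/

/-- A right-continuous process, adapted to `F`, started at `0`, and whose increments after any time
`s` are independent of `F s` and distributed as the process. -/
structure IsMarkovLevy (F : Filtration ℝ≥0 m) (Y : ℝ≥0 → Ω → ℝ) (P : Measure Ω) : Prop where
  adapted : Adapted F Y
  start_zero : ∀ ω, Y 0 ω = 0
  rightContinuous : ∀ ω t, ContinuousWithinAt (fun s ↦ Y s ω) (Set.Ici t) t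
  markov : ∀ (s : ℝ≥0) (A : Set Ω), MeasurableSet[F s] A → ∀ (u : ℕ → ℝ≥0) (B : Set (ℕ → ℝ)),
    MeasurableSet B → P (A ∩ {ω | (fun i ↦ Y (s + u i) ω - Y s ω) ∈ B}) =
      P A * P {ω | (fun i ↦ Y (u i) ω) ∈ B}

namespace IsMarkovLevy

variable {F : Filtration ℝ≥0 m} {Y : ℝ≥0 → Ω → ℝ} {P : Measure Ω}

lemma measurable (h : IsMarkovLevy F Y P) (t : ℝ≥0) : Measurable (Y t) :=
  (h.adapted t).mono (F.le t) le_rfl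

lemma measurable_comp (h : IsMarkovLevy F Y P) {σ : Ω → ℝ≥0} (hσ : Measurable σ) :
    Measurable fun ω ↦ Y (σ ω) ω :=
  (measurable_uncurry_of_rightContinuous h.measurable h.rightContinuous).comp
    (hσ.prodMk measurable_id)

lemma measurable_increments (h : IsMarkovLevy F Y P) {σ : Ω → ℝ≥0} (hσ : Measurable σ)
    (u : ℕ → ℝ≥0) : Measurable fun ω i ↦ Y (σ ω + u i) ω - Y (σ ω) ω :=
  measurable_pi_lambda _ fun i ↦
    (h.measurable_comp (hσ.add_const (u i))).sub (h.measurable_comp hσ)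

lemma map_restrict_of_const (h : IsMarkovLevy F Y P) {s : ℝ≥0} {A : Set Ω}
    (hA : MeasurableSet[F s] A) (u : ℕ → ℝ≥0) :
    (P.restrict A).map (fun ω i ↦ Y (s + u i) ω - Y s ω) =
      P A • P.map (fun ω i ↦ Y (u i) ω) := by
  have hA' := F.le s A hA
  have hm : Measurable fun ω i ↦ Y (s + u i) ω - Y s ω :=
    h.measurable_increments measurable_const u
  have hm' : Measurable fun ω i ↦ Y (u i) ω := measurable_pi_lambda _ fun i ↦ h.measurable _
  ext B hB
  rw [Measure.map_apply hm hB, Measure.restrict_apply (hm hB), Measure.smul_apply,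
    Measure.map_apply hm' hB, smul_eq_mul, Set.inter_comm]
  exact h.markov s A hA u B hB

/-- The Markov property at the grid times after a random time. -/
lemma lintegral_increments_gridTime (h : IsMarkovLevy F Y P) {σ : Ω → ℝ≥0}
    {A : Set Ω} (hA : ∀ t, MeasurableSet[F t] (A ∩ {ω | σ ω < t})) (u : ℕ → ℝ≥0) (k : ℕ)
    {φ : (ℕ → ℝ) → ENNReal} (hφ : Measurable φ) :
    ∫⁻ ω in A, φ (fun i ↦ Y (gridTime k (σ ω) + u i) ω - Y (gridTime k (σ ω)) ω) ∂P =
      P A * ∫⁻ ω, φ (fun i ↦ Y (u i) ω) ∂P := by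
  set c : ℝ≥0 := (k : ℝ≥0) + 1 with hc
  have hc0 : 0 < c := by positivity
  set S : ℕ → Set Ω := fun j ↦ A ∩ {ω | ⌊c * σ ω⌋₊ = j} with hS
  have hSj : ∀ j : ℕ, MeasurableSet[F (((j : ℝ≥0) + 1) / c)] (S j) := by
    intro j
    -- The grid time lies strictly after `σ`, so fixing its value involves only events `σ < t`; `σ`
    -- need not be a stopping time in the sense of `≤`.
    have : S j = (A ∩ {ω | σ ω < ((j : ℝ≥0) + 1) / c}) \ (A ∩ {ω | σ ω < (j : ℝ≥0) / c}) := by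
      ext ω
      simp only [hS, Set.mem_inter_iff, Set.mem_ofPred_eq, Set.mem_sdiff, lt_div_iff₀ hc0,
        Nat.floor_eq_iff (zero_le : 0 ≤ σ ω * c), mul_comm c]
      grind
    rw [this]
    exact (hA _).diff (F.mono (by gcongr; simp) _ (hA _))
  have hAU : A = ⋃ j, S j := by ext ω; simp [hS]
  have hdisj : Pairwise (Function.onFun Disjoint S) := by
    intro i j hij
    refine Set.disjoint_left.2 fun ω hi hj ↦ hij (hi.2.symm.trans hj.2)
  have hSm : ∀ j, MeasurableSet (S j) := fun j ↦ F.le _ _ (hSj j)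
  have hPA : P A = ∑' j, P (S j) := by
    conv_lhs => rw [hAU]
    exact measure_iUnion hdisj hSm
  conv_lhs => rw [hAU, lintegral_iUnion hSm hdisj]
  rw [hPA, ← ENNReal.tsum_mul_right]
  refine tsum_congr fun j ↦ ?_
  have hm : Measurable fun ω i ↦ Y (((j : ℝ≥0) + 1) / c + u i) ω - Y (((j : ℝ≥0) + 1) / c) ω :=
    h.measurable_increments measurable_const u
  have hm' : Measurable fun ω i ↦ Y (u i) ω := measurable_pi_lambda _ fun i ↦ h.measurable _
  calc _ = ∫⁻ ω in S j, φ (fun i ↦ Y (((j : ℝ≥0) + 1) / c + u i) ω -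
        Y (((j : ℝ≥0) + 1) / c) ω) ∂P := by
        refine setLIntegral_congr_fun (hSm j) fun ω hω ↦ ?_
        have : gridTime k (σ ω) = ((j : ℝ≥0) + 1) / c := by
          rw [gridTime, ← hc, hω.2]
        simp only [this]
    _ = _ := by
        rw [← lintegral_map hφ hm, h.map_restrict_of_const (hSj j) u, lintegral_smul_measure,
          lintegral_map hφ hm', smul_eq_mul]

/-- The strong Markov property at a random time `σ`, on an event `A` such that `A ∩ {σ < t}` is known
at time `t`. -/
lemma strongMarkov [IsProbabilityMeasure P] (h : IsMarkovLevy F Y P) {σ : Ω → ℝ≥0}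
    (hσ : Measurable σ) {A : Set Ω} (hA : ∀ t, MeasurableSet[F t] (A ∩ {ω | σ ω < t}))
    (u : ℕ → ℝ≥0) :
    (P.restrict A).map (fun ω i ↦ Y (σ ω + u i) ω - Y (σ ω) ω) =
      P A • P.map (fun ω i ↦ Y (u i) ω) := by
  have hm := h.measurable_increments hσ u
  have hm' : Measurable fun ω i ↦ Y (u i) ω := measurable_pi_lambda _ fun i ↦ h.measurable _
  have hfin : IsFiniteMeasure ((P.restrict A).map fun ω i ↦ Y (σ ω + u i) ω - Y (σ ω) ω) :=
    Measure.isFiniteMeasure_map _ _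
  refine ext_of_forall_lintegral_eq_of_IsFiniteMeasure fun φ ↦ ?_
  have hφ : Measurable fun g ↦ (φ g : ENNReal) := φ.continuous.measurable.coe_nnreal_ennreal
  rw [lintegral_map hφ hm, lintegral_smul_measure, lintegral_map hφ hm', smul_eq_mul]
  have hgm : ∀ k, Measurable fun ω ↦ gridTime k (σ ω) :=
    fun k ↦ (measurable_gridTime k).comp hσ
  -- The integrals at the grid times do not depend on `k`. They converge to the integral at `σ`
  -- because grid times decrease to within every right neighbourhood of `σ` and the paths are
  -- right-continuous.
  refine tendsto_nhds_unique ?_ (tendsto_const_nhds (f := (atTop : Filter ℕ)))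
  refine Tendsto.congr (fun k ↦ h.lintegral_increments_gridTime hA u k hφ) ?_
  refine tendsto_lintegral_of_dominated_convergence (fun _ ↦ (nndist φ 0 : ENNReal))
    (fun k ↦ hφ.comp (h.measurable_increments (hgm k) u))
    (fun k ↦ Eventually.of_forall fun ω ↦ ?_) ?_ (Eventually.of_forall fun ω ↦ ?_)
  · exact ENNReal.coe_le_coe.2 (BoundedContinuousFunction.NNReal.upper_bound φ _)
  · simp [ENNReal.mul_eq_top]
  · refine (ENNReal.tendsto_coe.2 ?_)
    refine (φ.continuous.tendsto _).comp (tendsto_pi_nhds.2 fun i ↦ ?_)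
    have h1 := tendsto_comp_gridTime (h.rightContinuous ω (σ ω))
    have h2 : Tendsto (fun k ↦ gridTime k (σ ω) + u i) atTop (𝓝[≥] (σ ω + u i)) := by
      have := tendsto_nhdsWithin_iff.1 (tendsto_gridTime (σ ω))
      refine tendsto_nhdsWithin_iff.2 ⟨this.1.add_const _, Eventually.of_forall fun k ↦ ?_⟩
      exact add_le_add_left (lt_gridTime k (σ ω)).le (u i)
    exact ((h.rightContinuous ω (σ ω + u i)).tendsto.comp h2).sub h1

end IsMarkovLevy

end

section

/-! ### The Markov property of a Lévy process -/

/-- The sequence lists `S` in increasing order and repeats the maximum, so that independence of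
increments along monotone sequences on `ℕ` covers finite sets of times. -/
lemma exists_monotone_enumeration (S : Finset ℝ≥0) (hS : 0 ∈ S) :
    ∃ t : ℕ → ℝ≥0, Monotone t ∧ t 0 = 0 ∧ ∀ s ∈ S, ∃ k, t k = s := by
  have hcard : 0 < S.card := Finset.card_pos.2 ⟨0, hS⟩
  have hmono : Monotone fun k : ℕ ↦ S.orderEmbOfFin rfl ⟨min k (S.card - 1), by omega⟩ := by
    intro a b hab
    refine (S.orderEmbOfFin rfl).monotone ?_
    simp only [Fin.mk_le_mk]
    omega
  have hex : ∀ s ∈ S, ∃ k : ℕ, S.orderEmbOfFin rfl ⟨min k (S.card - 1), by omega⟩ = s := by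
    intro s hs
    obtain ⟨i, rfl⟩ : s ∈ Set.range (S.orderEmbOfFin rfl) := by simpa using hs
    refine ⟨i, congrArg _ (Fin.ext ?_)⟩
    have := i.2
    simp only
    omega
  refine ⟨_, hmono, ?_, hex⟩
  obtain ⟨k, hk⟩ := hex 0 hS
  exact le_antisymm ((hmono (Nat.zero_le k)).trans hk.le) zero_le

variable {Ω : Type*} {m : MeasurableSpace Ω} {P : Measure Ω} {X : ℝ≥0 → Ω → ℝ}

namespace IsLevyProcess

lemma measurable_sub (hX : IsLevyProcess X P) (a b : ℝ≥0) :
    Measurable fun ω ↦ X b ω - X a ω := (hX.measurable b).sub (hX.measurable a)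

/-- The increments after time `s` are independent of the past of the process. -/
lemma indepFun_past_increments [IsProbabilityMeasure P] (hX : IsLevyProcess X P) (s : ℝ≥0) :
    IndepFun (fun ω (i : Set.Iic s) ↦ X i ω) (fun ω (j : ℝ≥0) ↦ X (s + j) ω - X s ω) P := by
  refine IndepFun.process_indepFun_process (fun i ↦ hX.measurable _)
    (fun j ↦ hX.measurable_sub _ _) fun I J ↦ ?_
  -- One sequence runs through `0`, `s` and all past and future times. Past values are sums of
  -- increments of index below `n`, future ones of index at least `n`, where `t n = s`.
  obtain ⟨t, ht, ht0, hex⟩ := exists_monotone_enumeration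
    (insert 0 (insert s (I.image (fun i : Set.Iic s ↦ (i : ℝ≥0)) ∪ J.image (fun j ↦ s + j)))) (by simp)
  obtain ⟨n, hn⟩ := hex s (by simp)
  have hI : ∀ i : I, ∃ k ≤ n, t k = (i : Set.Iic s) := by
    intro i
    obtain ⟨k, hk⟩ := hex ((i : Set.Iic s) : ℝ≥0) (by
      have := i.2
      simp only [Finset.mem_insert, Finset.mem_union, Finset.mem_image]
      exact Or.inr (Or.inr (Or.inl ⟨_, this, rfl⟩)))
    refine ⟨min k n, min_le_right _ _, ?_⟩
    rw [ht.map_min, hk, hn, min_eq_left (i : Set.Iic s).2]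
  have hJ : ∀ j : J, ∃ k, n ≤ k ∧ t k = s + j := by
    intro j
    obtain ⟨k, hk⟩ := hex (s + j) (by
      have := j.2
      simp only [Finset.mem_insert, Finset.mem_union, Finset.mem_image]
      exact Or.inr (Or.inr (Or.inr ⟨_, this, rfl⟩)))
    refine ⟨max k n, le_max_right _ _, ?_⟩
    rw [ht.map_max, hk, hn, max_eq_left (le_add_right le_rfl)]
  choose kI hkI hkI' using hI
  choose kJ hkJ hkJ' using hJ
  set inc : ℕ → Ω → ℝ := fun l ω ↦ X (t (l + 1)) ω - X (t l) ω with hinc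
  have hincm : ∀ l, Measurable (inc l) := fun l ↦ hX.measurable_sub _ _
  have hindep : Indep (⨆ l ∈ {l | l < n}, MeasurableSpace.comap (inc l) inferInstance)
      (⨆ l ∈ {l | n ≤ l}, MeasurableSpace.comap (inc l) inferInstance) P :=
    indep_iSup_of_disjoint (fun l ↦ (hincm l).comap_le) (hX.indep_increments.nat ht)
      (Set.disjoint_left.2 fun l hl hl' ↦ not_lt.2 (show n ≤ l from hl') hl)
  have hsum : ∀ a b, a ≤ b → ∀ ω, X (t b) ω - X (t a) ω = ∑ l ∈ Finset.Ico a b, inc l ω :=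
    fun a b hab ω ↦ (Finset.sum_Ico_sub (fun l ↦ X (t l) ω) hab).symm
  have hmeas : ∀ (T : Set ℕ) (K : Finset ℕ), (∀ l ∈ K, l ∈ T) →
      Measurable[⨆ l ∈ T, MeasurableSpace.comap (inc l) inferInstance]
        fun ω ↦ ∑ l ∈ K, inc l ω := by
    intro T K hK
    refine @Finset.measurable_fun_sum _ _ _ _ _ _ (_) _ _ fun l hl ↦ ?_
    exact (comap_measurable (inc l)).mono (le_iSup₂_of_le l (hK l hl) le_rfl) le_rfl
  have hpast : (fun ω (i : I) ↦ X (t (kI i)) ω - X (t 0) ω) =ᵐ[P]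
      fun ω (i : I) ↦ X (i : Set.Iic s) ω := by
    filter_upwards [hX.start_zero] with ω hω
    ext i
    rw [hkI', ht0, hω, sub_zero]
  refine IndepFun.congr ?_ hpast (Filter.EventuallyEq.refl _ _)
  refine indep_of_indep_of_le_left (indep_of_indep_of_le_right hindep ?_) ?_
  · refine measurable_iff_comap_le.1 ((@measurable_pi_iff _ _ _ (_) _ _).2 fun j ↦ ?_)
    simp_rw [← hkJ' j, ← hn, hsum _ _ (hkJ j)]
    exact hmeas _ _ fun l hl ↦ (Finset.mem_Ico.1 hl).1
  · refine measurable_iff_comap_le.1 ((@measurable_pi_iff _ _ _ (_) _ _).2 fun i ↦ ?_)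
    simp_rw [hsum _ _ (Nat.zero_le _)]
    exact hmeas _ _ fun l hl ↦ (Finset.mem_Ico.1 hl).2.trans_le (hkI i)

/-- The increments after time `s` are distributed as the process. -/
lemma map_increments [IsProbabilityMeasure P] (hX : IsLevyProcess X P) (s : ℝ≥0)
    (u : ℕ → ℝ≥0) :
    P.map (fun ω i ↦ X (s + u i) ω - X s ω) = P.map (fun ω i ↦ X (u i) ω) := by
  refine (map_eq_iff_forall_finset_map_restrict_eq (X := fun i ω ↦ X (s + u i) ω - X s ω)
    (Y := fun i ↦ X (u i))
    (measurable_pi_lambda _ fun i ↦ hX.measurable_sub _ _).aemeasurable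
    (measurable_pi_lambda _ fun i ↦ hX.measurable _).aemeasurable).2 fun I ↦ ?_
  obtain ⟨t, ht, ht0, hex⟩ := exists_monotone_enumeration (insert 0 (I.image u)) (by simp)
  have hI : ∀ i : I, ∃ k, t k = u i := fun i ↦ hex _ (by
    simp only [Finset.mem_insert, Finset.mem_image]
    exact Or.inr ⟨_, i.2, rfl⟩)
  choose k hk using hI
  -- By independence both joint laws are product measures, and by stationarity the factors agree.
  have hlaw : P.map (fun ω l ↦ X (s + t (l + 1)) ω - X (s + t l) ω) =
      P.map (fun ω l ↦ X (t (l + 1)) ω - X (t l) ω) := by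
    rw [(iIndepFun_iff_map_fun_eq_infinitePi_map
        fun l ↦ hX.measurable_sub (s + t l) (s + t (l + 1))).1
        (hX.indep_increments.nat (t := fun l ↦ s + t l) (ht.const_add s)),
      (iIndepFun_iff_map_fun_eq_infinitePi_map
        fun l ↦ hX.measurable_sub (t l) (t (l + 1))).1 (hX.indep_increments.nat ht)]
    congr 1
    ext1 l
    have hl := ht (Nat.le_succ l)
    have h1 := hX.stationary_increments (s + t l) (s + t (l + 1)) (by gcongr)
    have h2 := hX.stationary_increments (t l) (t (l + 1)) hl
    rw [add_tsub_add_eq_tsub_left] at h1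
    exact h1.map_eq.trans h2.map_eq.symm
  have hG : Measurable fun (v : ℕ → ℝ) (i : I) ↦ ∑ l ∈ Finset.range (k i), v l := by fun_prop
  have h1 : (fun ω ↦ I.restrict fun i ↦ X (s + u i) ω - X s ω) =
      (fun (v : ℕ → ℝ) (i : I) ↦ ∑ l ∈ Finset.range (k i), v l) ∘
        fun ω l ↦ X (s + t (l + 1)) ω - X (s + t l) ω := by
    ext ω i
    simp only [Finset.restrict, Function.comp_apply]
    rw [Finset.sum_range_sub (fun l ↦ X (s + t l) ω), hk, ht0, add_zero]
  have h2 : (fun ω ↦ I.restrict fun i ↦ X (u i) ω) =ᵐ[P]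
      (fun (v : ℕ → ℝ) (i : I) ↦ ∑ l ∈ Finset.range (k i), v l) ∘
        fun ω l ↦ X (t (l + 1)) ω - X (t l) ω := by
    filter_upwards [hX.start_zero] with ω hω
    ext i
    simp only [Finset.restrict, Function.comp_apply]
    rw [Finset.sum_range_sub (fun l ↦ X (t l) ω), hk, ht0, hω, sub_zero]
  rw [Measure.map_congr h2, h1, ← Measure.map_map hG, hlaw, Measure.map_map hG]
  · exact measurable_pi_lambda _ fun l ↦ hX.measurable_sub _ _
  · exact measurable_pi_lambda _ fun l ↦ hX.measurable_sub _ _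

variable [P.IsComplete]

lemma markov [IsProbabilityMeasure P] (hX : IsLevyProcess X P) (s : ℝ≥0) {A : Set Ω}
    (hA : MeasurableSet[generatedFiltration P X hX.measurable s] A) (u : ℕ → ℝ≥0)
    {B : Set (ℕ → ℝ)} (hB : MeasurableSet B) :
    P (A ∩ {ω | (fun i ↦ X (s + u i) ω - X s ω) ∈ B}) =
      P A * P {ω | (fun i ↦ X (u i) ω) ∈ B} := by
  -- Up to a null set, `A` is an event of the uncompleted past, hence a preimage under the past
  -- path, to which independence applies.
  obtain ⟨A', hA', hAA'⟩ := hA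
  have hA'' : MeasurableSet[MeasurableSpace.comap (fun ω (j : Set.Iic s) ↦ X j ω) inferInstance]
      A' := by
    rw [← Filtration.natural_eq_comap X fun s ↦ (hX.measurable s).stronglyMeasurable]
    exact hA'
  obtain ⟨C, hC, rfl⟩ := hA''
  have h1 : IndepFun (fun ω (i : Set.Iic s) ↦ X i ω) (fun ω i ↦ X (s + u i) ω - X s ω) P :=
    (hX.indepFun_past_increments s).comp (φ := id)
      (ψ := fun (g : ℝ≥0 → ℝ) (i : ℕ) ↦ g (u i)) measurable_id (by fun_prop)
  have h2 := congrArg (fun μ ↦ μ B) (hX.map_increments s u)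
  rw [Measure.map_apply (measurable_pi_lambda _ fun l ↦ hX.measurable_sub _ _) hB,
    Measure.map_apply (measurable_pi_lambda _ fun l ↦ hX.measurable _) hB] at h2
  rw [measure_congr hAA', measure_congr (hAA'.inter (Filter.EventuallyEq.refl _
    {ω | (fun i ↦ X (s + u i) ω - X s ω) ∈ B}))]
  exact (h1.measure_inter_preimage_eq_mul _ _ hC hB).trans (by rw [h2]; rfl)

end IsLevyProcess

/-! ### A version of the process that is right-continuous at every sample point -/

/-- The event that the path of `X` is right-continuous and starts at `0`. -/
def regularSet (X : ℝ≥0 → Ω → ℝ) : Set Ω :=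
  {ω | X 0 ω = 0 ∧ ∀ t, ContinuousWithinAt (fun s ↦ X s ω) (Set.Ici t) t}

/-- The version of `X` which vanishes where the path of `X` is not right-continuous. -/
def regularVersion (X : ℝ≥0 → Ω → ℝ) (t : ℝ≥0) : Ω → ℝ := (regularSet X).indicator (X t)

namespace IsLevyProcess

lemma ae_mem_regularSet (hX : IsLevyProcess X P) : ∀ᵐ ω ∂P, ω ∈ regularSet X := by
  filter_upwards [hX.start_zero, hX.cadlag] with ω h0 h
  exact ⟨h0, fun t ↦ (h t).1⟩

lemma ae_regularVersion_eq (hX : IsLevyProcess X P) :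
    ∀ᵐ ω ∂P, ∀ t, regularVersion X t ω = X t ω := by
  filter_upwards [hX.ae_mem_regularSet] with ω hω t
  exact Set.indicator_of_mem hω _

variable [P.IsComplete]

/-- Events that agree almost surely belong to the same σ-algebras of the completed filtration. -/
lemma measurableSet_congr (hX : IsLevyProcess X P) {t : ℝ≥0} {A B : Set Ω}
    (hA : MeasurableSet[generatedFiltration P X hX.measurable t] A) (h : B =ᵐ[P] A) :
    MeasurableSet[generatedFiltration P X hX.measurable t] B := by
  obtain ⟨C, hC, hAC⟩ := hA
  exact ⟨C, hC, h.trans hAC⟩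

lemma adapted (hX : IsLevyProcess X P) :
    Adapted (generatedFiltration P X hX.measurable) X := by
  intro t B hB
  exact ⟨_, (Filtration.stronglyAdapted_natural
    fun s ↦ (hX.measurable s).stronglyMeasurable).adapted t hB, Filter.EventuallyEq.refl _ _⟩

lemma isMarkovLevy_regularVersion [IsProbabilityMeasure P] (hX : IsLevyProcess X P) :
    IsMarkovLevy (generatedFiltration P X hX.measurable) (regularVersion X) P where
  adapted t B hB := by
    refine hX.measurableSet_congr (hX.adapted t hB) ?_
    filter_upwards [hX.ae_regularVersion_eq] with ω hω
    exact congrArg (· ∈ B) (hω t)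
  start_zero ω := by
    by_cases h : ω ∈ regularSet X
    · exact (Set.indicator_of_mem h _).trans h.1
    · exact Set.indicator_of_notMem h _
  rightContinuous ω t := by
    by_cases h : ω ∈ regularSet X
    · simpa only [regularVersion, Set.indicator_of_mem h] using h.2 t
    · simpa only [regularVersion, Set.indicator_of_notMem h] using continuousWithinAt_const
  markov s A hA u B hB := by
    rw [← hX.markov s hA u hB |>.trans (congrArg _ (measure_congr ?_))]
    · refine measure_congr ((Filter.EventuallyEq.refl _ _).inter ?_)
      filter_upwards [hX.ae_regularVersion_eq] with ω hω
      exact congrArg (· ∈ B) (funext fun i ↦ by rw [hω, hω])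
    · filter_upwards [hX.ae_regularVersion_eq] with ω hω
      exact congrArg (· ∈ B) (funext fun i ↦ by rw [hω])

end IsLevyProcess

end

section

/-! ### Measurability of passage times -/

lemma lt_top_and_untopA_lt_iff {c : WithTop ℝ≥0} {t : ℝ≥0} :
    c < ⊤ ∧ c.untopA < t ↔ c < t := by
  cases c with
  | top => exact iff_of_false (fun h ↦ lt_irrefl _ h.1) not_top_lt
  | coe a => exact ⟨fun h ↦ WithTop.coe_lt_coe.2 h.2,
      fun h ↦ ⟨WithTop.coe_lt_top a, WithTop.coe_lt_coe.1 h⟩⟩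

lemma measurable_levelTime (n : ℕ) : Measurable fun g : ℕ → ℝ ↦ levelTime denseTime g n :=
  Measurable.iInf fun i ↦ Measurable.ite (measurableSet_lt (measurable_pi_apply i) measurable_const)
    measurable_const measurable_const

lemma measurable_passageTime : Measurable fun g : ℕ → ℝ ↦ passageTime denseTime g :=
  Measurable.iSup measurable_levelTime

/-- A right-continuous path is nonpositive at its first hitting time of `(-∞, 0]`. -/
lemma le_zero_of_hitTime_eq {f : ℝ≥0 → ℝ} (hf : ∀ t, ContinuousWithinAt f (Set.Ici t) t) {t : ℝ≥0}
    (h : hitTime f = t) : f t ≤ 0 := by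
  by_contra! hlt
  obtain ⟨s, hs, hs'⟩ := exists_forall_gt_of_rightContinuous (hf t) hlt
  obtain ⟨i, hi, hi'⟩ := hittingAfter_lt_iff.1 (h.trans_lt (WithTop.coe_lt_coe.2 hs))
  have hti : t ≤ i := WithTop.coe_le_coe.1
    (h.symm.le.trans (hittingAfter_le_of_mem hi.1 hi'))
  exact absurd (hs' i hti hi.2) (not_lt.2 hi')

/-- A hit exactly at `t` is visible in `f t`, so nothing after `t` is needed. This is how the
stopping time property avoids right-continuity of the filtration. -/
lemma hitTime_le_iff {f : ℝ≥0 → ℝ} (hf : ∀ t, ContinuousWithinAt f (Set.Ici t) t) {t : ℝ≥0} :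
    hitTime f ≤ t ↔ hitTime f < t ∨ f t ≤ 0 := by
  constructor
  · intro h
    rcases h.lt_or_eq with h | h
    · exact Or.inl h
    · exact Or.inr (le_zero_of_hitTime_eq hf h)
  · rintro (h | h)
    · exact h.le
    · exact hittingAfter_le_of_mem zero_le h

namespace IsMarkovLevy

variable {Ω : Type*} {m : MeasurableSpace Ω} {F : Filtration ℝ≥0 m} {Y : ℝ≥0 → Ω → ℝ}
  {P : Measure Ω}

lemma rightContinuous_const_add (h : IsMarkovLevy F Y P) (y : ℝ) (ω : Ω) (t : ℝ≥0) :
    ContinuousWithinAt (fun s ↦ y + Y s ω) (Set.Ici t) t :=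
  continuousWithinAt_const.add (h.rightContinuous ω t)

lemma measurable_passageTime (h : IsMarkovLevy F Y P) (y : ℝ) :
    Measurable fun ω ↦ passageTime id fun t ↦ y + Y t ω := by
  have hm : Measurable fun ω k ↦ y + Y (denseTime k) ω :=
    measurable_pi_lambda _ fun k ↦ (h.measurable _).const_add y
  simp_rw [← fun ω ↦ passageTime_denseTime (h.rightContinuous_const_add y ω)]
  exact DefaultSwap.measurable_passageTime.comp hm

lemma measurable_levelTime (h : IsMarkovLevy F Y P) (y : ℝ) (n : ℕ) :
    Measurable fun ω ↦ levelTime id (fun t ↦ y + Y t ω) n := by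
  have hm : Measurable fun ω k ↦ y + Y (denseTime k) ω :=
    measurable_pi_lambda _ fun k ↦ (h.measurable _).const_add y
  simp_rw [← fun ω ↦ levelTime_denseTime (h.rightContinuous_const_add y ω)]
  exact (DefaultSwap.measurable_levelTime n).comp hm

lemma measurableSet_levelTime_lt (h : IsMarkovLevy F Y P) (y : ℝ) (n : ℕ) (t : ℝ≥0) :
    MeasurableSet[F t] {ω | levelTime id (fun t ↦ y + Y t ω) n < t} := by
  have : {ω | levelTime id (fun t ↦ y + Y t ω) n < t} =
      ⋃ k ∈ {k | denseTime k < t}, {ω | y + Y (denseTime k) ω < 1 / ((n : ℝ) + 1)} := by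
    ext ω
    rw [Set.mem_ofPred_eq, ← levelTime_denseTime (h.rightContinuous_const_add y ω),
      levelTime_lt_iff]
    simp only [Set.mem_ofPred_eq, Set.mem_iUnion, WithTop.coe_lt_coe, exists_prop, and_comm]
  rw [this]
  refine MeasurableSet.biUnion (Set.to_countable _) fun k hk ↦ ?_
  have hm : Measurable[F t] fun ω ↦ y + Y (denseTime k) ω :=
    (h.adapted.measurable_le (le_of_lt hk)).const_add y
  exact hm measurableSet_Iio

/-- The strict inequality provides a dense time before `t` by which every level has been crossed. -/
lemma measurableSet_passageTime_lt (h : IsMarkovLevy F Y P) (y : ℝ) (t : ℝ≥0) :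
    MeasurableSet[F t] {ω | passageTime id (fun t ↦ y + Y t ω) < t} := by
  have : {ω | passageTime id (fun t ↦ y + Y t ω) < t} =
      ⋃ k ∈ {k | denseTime k < t}, ⋂ n, {ω | levelTime id (fun t ↦ y + Y t ω) n < denseTime k} := by
    ext ω
    simp only [Set.mem_ofPred_eq, passageTime_lt_iff, Set.mem_iUnion, Set.mem_iInter,
      WithTop.coe_lt_coe, exists_prop]
  rw [this]
  refine MeasurableSet.biUnion (Set.to_countable _) fun k hk ↦ MeasurableSet.iInter fun n ↦ ?_
  exact F.mono (le_of_lt hk) _ (h.measurableSet_levelTime_lt y n _)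

lemma strongMarkov_apply [IsProbabilityMeasure P] (h : IsMarkovLevy F Y P) {σ : Ω → ℝ≥0}
    (hσ : Measurable σ) {A : Set Ω} (hA : ∀ t, MeasurableSet[F t] (A ∩ {ω | σ ω < t}))
    (u : ℕ → ℝ≥0) {B : Set (ℕ → ℝ)} (hB : MeasurableSet B) :
    P ({ω | (fun i ↦ Y (σ ω + u i) ω - Y (σ ω) ω) ∈ B} ∩ A) =
      P A * P {ω | (fun i ↦ Y (u i) ω) ∈ B} := by
  have h1 := congrArg (fun μ ↦ μ B) (h.strongMarkov hσ hA u)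
  have hm := h.measurable_increments hσ u
  have hm' : Measurable fun ω i ↦ Y (u i) ω := measurable_pi_lambda _ fun i ↦ h.measurable _
  simp only [Measure.smul_apply, smul_eq_mul] at h1
  rwa [Measure.map_apply hm hB, Measure.restrict_apply (hm hB), Measure.map_apply hm' hB] at h1

/-! ### Quasi-left-continuity at the default time -/

/-- Right-continuity at time `0`, where the process vanishes, gives pointwise convergence, hence
convergence in measure. -/
lemma tendsto_measure_lt [IsProbabilityMeasure P] (h : IsMarkovLevy F Y P) {c : ℝ} (hc : 0 < c) :
    Tendsto (fun j : ℕ ↦ P {ω | c < Y (1 / ((j : ℝ≥0) + 1)) ω}) atTop (𝓝 0) := by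
  have h0 : Tendsto (fun j : ℕ ↦ 1 / ((j : ℝ≥0) + 1)) atTop (𝓝[≥] 0) :=
    tendsto_nhdsWithin_iff.2 ⟨tendsto_one_div_add_atTop_nhds_zero_nat,
      Eventually.of_forall fun _ ↦ Set.mem_Ici.2 zero_le⟩
  have h1 : TendstoInMeasure P (fun (j : ℕ) ω ↦ Y (1 / ((j : ℝ≥0) + 1)) ω) atTop fun _ ↦ 0 := by
    refine tendstoInMeasure_of_tendsto_ae (fun j ↦ (h.measurable _).aestronglyMeasurable)
      (Eventually.of_forall fun ω ↦ ?_)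
    have := (h.rightContinuous ω 0).tendsto.comp h0
    rwa [h.start_zero ω] at this
  refine tendsto_of_tendsto_of_tendsto_of_le_of_le tendsto_const_nhds
    (tendstoInMeasure_iff_dist.1 h1 c hc) (fun _ ↦ zero_le) fun j ↦ ?_
  refine measure_mono fun ω (hω : c < _) ↦ ?_
  simp only [Set.mem_ofPred_eq, Real.dist_eq, sub_zero]
  exact hω.le.trans (le_abs_self _)

/-- Strong Markov at the level time, on the event that it is finite; there `untopA` is the true
value. The probability of that event is bounded by `1`. -/
lemma measure_increment_levelTime_le [IsProbabilityMeasure P] (h : IsMarkovLevy F Y P) (y c : ℝ)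
    (t : ℝ≥0) (n : ℕ) :
    P {ω | levelTime id (fun t ↦ y + Y t ω) n < ⊤ ∧
      c < Y ((levelTime id (fun t ↦ y + Y t ω) n).untopA + t) ω -
        Y (levelTime id (fun t ↦ y + Y t ω) n).untopA ω} ≤ P {ω | c < Y t ω} := by
  have hA : ∀ t : ℝ≥0, MeasurableSet[F t] ({ω | levelTime id (fun t ↦ y + Y t ω) n < ⊤} ∩
      {ω | (levelTime id (fun t ↦ y + Y t ω) n).untopA < t}) := by
    intro t
    convert! h.measurableSet_levelTime_lt y n t using 1
    ext ω
    exact lt_top_and_untopA_lt_iff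
  have := h.strongMarkov_apply (h.measurable_levelTime y n).untopA hA (fun _ ↦ t)
    (B := {g | c < g 0}) (measurableSet_lt measurable_const (measurable_pi_apply 0))
  calc _ = _ := by
        congr 1
        ext ω
        exact and_comm
    _ = _ := this
    _ ≤ _ := mul_le_of_le_one_left zero_le prob_le_one

/-- The default time is almost surely the passage time: the process does not jump at a time at which
it is announced to reach `0`. -/
lemma ae_hitTime_eq_passageTime [IsProbabilityMeasure P] (h : IsMarkovLevy F Y P) (y : ℝ) :
    ∀ᵐ ω ∂P, hitTime (fun t ↦ y + Y t ω) = passageTime id fun t ↦ y + Y t ω := by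
  set E : ℕ → ℕ → ℕ → Set Ω := fun c j n ↦ {ω | levelTime id (fun t ↦ y + Y t ω) n < ⊤ ∧
    1 / ((c : ℝ) + 1) < Y ((levelTime id (fun t ↦ y + Y t ω) n).untopA + 1 / ((j : ℝ≥0) + 1)) ω -
        Y (levelTime id (fun t ↦ y + Y t ω) n).untopA ω}
  have hnull : ∀ c J, P {ω | ∀ j ≥ J, ∃ N, ∀ n ≥ N, ω ∈ E c j n} = 0 := by
    intro c J
    refine le_antisymm (ge_of_tendsto (h.tendsto_measure_lt (c := 1 / ((c : ℝ) + 1)) (by positivity))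
      (eventually_atTop.2 ⟨J, fun j hj ↦ ?_⟩)) zero_le
    -- A lower limit of events has probability at most the supremum of theirs. The bound is uniform
    -- in `n` and vanishes as `j → ∞`.
    calc _ ≤ P (⋃ N, ⋂ n ≥ N, E c j n) :=
          measure_mono fun ω hω ↦ by simpa using hω j hj
      _ = ⨆ N, P (⋂ n ≥ N, E c j n) := by
          refine (monotone_nat_of_le_succ fun N ↦ ?_).measure_iUnion
          exact Set.biInter_subset_biInter_left fun n (hn : N + 1 ≤ n) ↦ show N ≤ n by omega
      _ ≤ _ := iSup_le fun N ↦ (measure_mono (Set.biInter_subset_of_mem (le_refl N))).trans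
          (h.measure_increment_levelTime_le y _ _ N)
  have hall : ∀ᵐ ω ∂P, ∀ c J, ¬ ∀ j ≥ J, ∃ N, ∀ n ≥ N, ω ∈ E c j n := by
    refine ae_all_iff.2 fun c ↦ ae_all_iff.2 fun J ↦ ?_
    rw [ae_iff]
    simpa using hnull c J
  filter_upwards [hall] with ω hω
  refine le_antisymm (not_lt.1 fun hlt ↦ ?_) (passageTime_le_hitTime _)
  obtain ⟨c, d, hd, H⟩ :=
    exists_increment_of_passageTime_lt_hitTime (h.rightContinuous_const_add y ω) hlt
  obtain ⟨J, hJ⟩ := exists_nat_one_div_lt hd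
  refine hω c J fun j hj ↦ ?_
  obtain ⟨N, hN⟩ := H (1 / ((j : ℝ≥0) + 1)) (by positivity)
    (lt_of_le_of_lt (Nat.one_div_le_one_div hj) hJ)
  refine ⟨N, fun n hn ↦ ⟨(hN n hn).1, ?_⟩⟩
  simpa only [add_sub_add_left_eq_sub] using (hN n hn).2

end IsMarkovLevy

end

section

/-! ### Discounting -/

@[simp] lemma discount_top (r : ℝ) : discount r ⊤ = 0 := rfl

lemma discount_coe (r : ℝ) (t : ℝ≥0) : discount r (t : WithTop ℝ≥0) = Real.exp (-r * t) := rfl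

lemma discount_nonneg (r : ℝ) (c : WithTop ℝ≥0) : 0 ≤ discount r c := by
  cases c with
  | top => exact le_rfl
  | coe t => exact (Real.exp_pos _).le

lemma discount_antitone {r : ℝ} (hr : 0 < r) : Antitone (discount r) := by
  intro s t hst
  cases t with
  | top => exact discount_nonneg r s
  | coe t =>
    lift s to ℝ≥0 using (hst.trans_lt (WithTop.coe_lt_top t)).ne
    rw [discount_coe, discount_coe]
    have : (s : ℝ) ≤ t := by exact_mod_cast WithTop.coe_le_coe.1 hst
    gcongr Real.exp ?_
    nlinarith

lemma discount_zero (r : ℝ) : discount r 0 = 1 := by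
  change Real.exp (-r * ((0 : ℝ≥0) : ℝ)) = 1
  simp

lemma discount_le_one {r : ℝ} (hr : 0 < r) (c : WithTop ℝ≥0) : discount r c ≤ 1 :=
  (discount_antitone hr zero_le).trans (discount_zero r).le

lemma abs_discount_le_one {r : ℝ} (hr : 0 < r) (c : WithTop ℝ≥0) : |discount r c| ≤ 1 :=
  abs_le.2 ⟨by linarith [discount_nonneg r c], discount_le_one hr c⟩

lemma measurable_discount (r : ℝ) : Measurable (discount r) := by
  have h : discount r = fun c ↦ if c = ⊤ then 0 else Real.exp (-r * (c.untopA : ℝ≥0)) := by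
    ext c
    cases c with
    | top => simp
    | coe t => rw [if_neg (WithTop.coe_ne_top)]; rfl
  rw [h]
  refine Measurable.ite (measurableSet_singleton ⊤) measurable_const ?_
  have := (measurable_id (α := WithTop ℝ≥0)).untopA
  exact Real.measurable_exp.comp ((measurable_coe_nnreal_real.comp this).const_mul _)

lemma discount_add (r : ℝ) (s : ℝ≥0) (c : WithTop ℝ≥0) :
    discount r (s + c) = Real.exp (-r * s) * discount r c := by
  cases c with
  | top => rw [WithTop.add_top]; simp
  | coe t =>
    rw [← WithTop.coe_add, discount_coe, discount_coe, ← Real.exp_add]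
    push_cast
    ring_nf

/-- This turns every cash flow into a combination of discount factors; an infinite endpoint
contributes `0`, in accordance with `discount r ⊤ = 0`. -/
lemma premiumLeg_eq {r : ℝ} (hr : 0 < r) (c : ℝ) {s t : WithTop ℝ≥0} (hst : s ≤ t) :
    premiumLeg r c s t = c / r * (discount r s - discount r t) := by
  have hint : ∀ a : ℝ≥0, IntegrableOn (fun u : ℝ ↦ Real.exp (-r * u)) (Set.Ici (a : ℝ)) :=
    fun a ↦ (integrableOn_Ici_iff_integrableOn_Ioi).2
      (integrableOn_exp_mul_Ioi (neg_neg_of_pos hr) _)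
  have hval : ∀ a : ℝ≥0, ∫ u in Set.Ici (a : ℝ), Real.exp (-r * u) = discount r a / r := by
    intro a
    rw [integral_Ici_eq_integral_Ioi, integral_exp_mul_Ioi (neg_neg_of_pos hr), discount_coe]
    field_simp
  rw [premiumLeg, integral_mul_const]
  cases s with
  | top =>
    obtain rfl := top_le_iff.1 hst
    have : {u : ℝ | 0 ≤ u ∧ (⊤ : WithTop ℝ≥0) ≤ (u.toNNReal : WithTop ℝ≥0) ∧
        (u.toNNReal : WithTop ℝ≥0) < ⊤} = ∅ := by
      ext u
      simp only [Set.mem_ofPred_eq, Set.mem_empty_iff_false, iff_false]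
      exact fun h ↦ not_lt.2 h.2.1 h.2.2
    rw [this, Measure.restrict_empty, integral_zero_measure, sub_self, mul_zero, zero_mul]
  | coe a =>
    have hle : ∀ u : ℝ, (0 ≤ u ∧ (a : WithTop ℝ≥0) ≤ (u.toNNReal : WithTop ℝ≥0)) ↔ (a : ℝ) ≤ u := by
      intro u
      rw [WithTop.coe_le_coe]
      constructor
      · rintro ⟨h0, h⟩
        rwa [← NNReal.coe_le_coe, Real.coe_toNNReal _ h0] at h
      · intro h
        exact ⟨a.2.trans h, (Real.le_toNNReal_iff_coe_le (a.2.trans h)).2 h⟩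
    cases t with
    | top =>
      have : {u : ℝ | 0 ≤ u ∧ (a : WithTop ℝ≥0) ≤ (u.toNNReal : WithTop ℝ≥0) ∧
          (u.toNNReal : WithTop ℝ≥0) < ⊤} = Set.Ici (a : ℝ) := by
        ext u
        simp only [Set.mem_ofPred_eq, Set.mem_Ici, hle, WithTop.coe_lt_top, and_true]
      rw [this, hval, discount_top]
      ring
    | coe b =>
      have hab : (a : ℝ) ≤ b := by exact_mod_cast WithTop.coe_le_coe.1 hst
      have : {u : ℝ | 0 ≤ u ∧ (a : WithTop ℝ≥0) ≤ (u.toNNReal : WithTop ℝ≥0) ∧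
          (u.toNNReal : WithTop ℝ≥0) < b} = Set.Ici (a : ℝ) \ Set.Ici (b : ℝ) := by
        ext u
        simp only [Set.mem_ofPred_eq, Set.mem_sdiff, Set.mem_Ici, ← and_assoc, hle]
        refine and_congr_right fun hu ↦ ?_
        rw [WithTop.coe_lt_coe, ← NNReal.coe_lt_coe, Real.coe_toNNReal _ (a.2.trans hu), not_le]
      rw [this, setIntegral_sdiff measurableSet_Ici (hint a) (Set.Ici_subset_Ici.2 hab), hval, hval]
      ring

/-! ### The strong Markov property at an exercise time -/

lemma measurable_time_prodMk {Ω : Type*} {m : MeasurableSpace Ω} {Y : ℝ≥0 → Ω → ℝ} {i : ℝ≥0}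
    (h : Measurable fun p : Set.Iic i × Ω ↦ Y p.1 p.2) :
    Measurable fun p : Set.Iic i × Ω ↦ ((p.1 : ℝ≥0), Y p.1 p.2) :=
  measurable_fst.subtype_val.prodMk h

namespace IsMarkovLevy

variable {Ω : Type*} {m : MeasurableSpace Ω} {F : Filtration ℝ≥0 m} {Y : ℝ≥0 → Ω → ℝ}
  {P : Measure Ω} {τ : Ω → WithTop ℝ≥0}

/-- Time is carried along with the state, so that the joint law includes the discount factor at `τ`.
-/
lemma isStronglyProgressive_prodMk (h : IsMarkovLevy F Y P) :
    IsStronglyProgressive F fun t ω ↦ (t, Y t ω) := by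
  refine IsProgressive.isStronglyProgressive fun i ↦ ?_
  exact @measurable_time_prodMk Ω (F i) Y i
    ((isStronglyProgressive_of_rightContinuous h.adapted h.rightContinuous).isProgressive i)

/-- The information on the exercise time and on the state at that time, before the passage time, is
known at the exercise time. -/
lemma measurableSet_stopped_inter (h : IsMarkovLevy F Y P) (hτ : IsStoppingTime F τ) (x : ℝ)
    {S : Set (ℝ≥0 × ℝ)} (hS : MeasurableSet S) (t : ℝ≥0) :
    MeasurableSet[F t] ((stoppedValue (fun t ω ↦ (t, Y t ω)) τ ⁻¹' S ∩
      {ω | τ ω < passageTime id fun t ↦ x + Y t ω}) ∩ {ω | (τ ω).untopA < t}) := by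
  have : (stoppedValue (fun t ω ↦ (t, Y t ω)) τ ⁻¹' S ∩
      {ω | τ ω < passageTime id fun t ↦ x + Y t ω}) ∩ {ω | (τ ω).untopA < t} =
      ⋃ k ∈ {k | denseTime k < t}, (stoppedValue (fun t ω ↦ (t, Y t ω)) τ ⁻¹' S ∩
        {ω | τ ω ≤ denseTime k} ∩ {ω | τ ω < denseTime k}) \
          {ω | passageTime id (fun t ↦ x + Y t ω) < denseTime k} := by
    ext ω
    simp only [Set.mem_inter_iff, Set.mem_ofPred_eq, Set.mem_iUnion, Set.mem_sdiff, not_lt,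
      exists_prop]
    constructor
    · rintro ⟨⟨hs, hp⟩, ht⟩
      have ht' := lt_top_and_untopA_lt_iff.1 ⟨hp.trans_le le_top, ht⟩
      -- A dense time between `τ` and both `t` and the passage time: at that time, before `t`, it is
      -- already known that `τ` has occurred and that passage has not.
      obtain ⟨k, hk, hk'⟩ := exists_denseTime_between_withTop (lt_min hp ht')
      rw [lt_min_iff] at hk'
      exact ⟨k, WithTop.coe_lt_coe.1 hk'.2, ⟨⟨hs, hk.le⟩, hk⟩, hk'.1.le⟩
    · rintro ⟨k, hk, ⟨⟨hs, -⟩, hlt⟩, hp⟩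
      exact ⟨⟨hs, hlt.trans_le hp⟩,
        (lt_top_and_untopA_lt_iff.2 (hlt.trans (WithTop.coe_lt_coe.2 hk))).2⟩
  rw [this]
  refine MeasurableSet.biUnion (Set.to_countable _) fun k hk ↦ ?_
  refine F.mono (le_of_lt hk) _ (MeasurableSet.diff ?_ (h.measurableSet_passageTime_lt x _))
  exact (measurableSet_preimage_stoppedValue_inter h.isStronglyProgressive_prodMk hτ hS _).inter
    (hτ.measurableSet_lt _)

/-- The state reached at an exercise time before the passage time is independent of the path after
that time, which is distributed as the process. -/
lemma map_prodMk_restrict [IsProbabilityMeasure P] (h : IsMarkovLevy F Y P)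
    (hτ : IsStoppingTime F τ) (x : ℝ) (u : ℕ → ℝ≥0) :
    (P.restrict {ω | τ ω < passageTime id fun t ↦ x + Y t ω}).map
        (fun ω ↦ (stoppedValue (fun t ω ↦ (t, Y t ω)) τ ω,
          fun i ↦ Y ((τ ω).untopA + u i) ω - Y (τ ω).untopA ω)) =
      ((P.restrict {ω | τ ω < passageTime id fun t ↦ x + Y t ω}).map
        (stoppedValue (fun t ω ↦ (t, Y t ω)) τ)).prod (P.map fun ω i ↦ Y (u i) ω) := by
  set A := {ω | τ ω < passageTime id fun t ↦ x + Y t ω}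
  have hσ : Measurable fun ω ↦ (τ ω).untopA := hτ.measurable'.untopA
  have hW : Measurable (stoppedValue (fun t ω ↦ (t, Y t ω)) τ) :=
    hσ.prodMk (h.measurable_comp hσ)
  have hm := h.measurable_increments hσ u
  have hm' : Measurable fun ω i ↦ Y (u i) ω := measurable_pi_lambda _ fun i ↦ h.measurable _
  have : IsProbabilityMeasure (P.map fun ω i ↦ Y (u i) ω) :=
    Measure.isProbabilityMeasure_map hm'.aemeasurable
  have : IsFiniteMeasure ((P.restrict A).map (stoppedValue (fun t ω ↦ (t, Y t ω)) τ)) :=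
    Measure.isFiniteMeasure_map _ _
  -- On rectangles this is strong Markov, the condition `S` on time and state being absorbed into
  -- the conditioning event.
  refine (Measure.prod_eq fun S B hS hB ↦ ?_).symm
  rw [Measure.map_apply (hW.prodMk hm) (hS.prod hB), Measure.map_apply hW hS,
    Measure.map_apply hm' hB, Measure.restrict_apply ((hW.prodMk hm) (hS.prod hB)),
    Measure.restrict_apply (hW hS)]
  refine Eq.trans (congrArg P ?_) (h.strongMarkov_apply hσ (h.measurableSet_stopped_inter hτ x hS) u hB)
  ext ω
  simp only [Set.mem_inter_iff, Set.mem_preimage, Set.mem_prod, Set.mem_ofPred_eq]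
  tauto

/-- The value at an exercise time of a unit payment at the passage time. -/
lemma setIntegral_discount_passageTime [IsProbabilityMeasure P] (h : IsMarkovLevy F Y P)
    (hτ : IsStoppingTime F τ) {r : ℝ} (hr : 0 < r) (x : ℝ) :
    ∫ ω in {ω | τ ω < passageTime id fun t ↦ x + Y t ω},
        discount r (passageTime id fun t ↦ x + Y t ω) ∂P =
      ∫ ω in {ω | τ ω < passageTime id fun t ↦ x + Y t ω}, discount r (τ ω) *
        ∫ ω', discount r (passageTime id fun t ↦ (x + stoppedValue Y τ ω) + Y t ω') ∂P ∂P := by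
  have hA : MeasurableSet {ω | τ ω < passageTime id fun t ↦ x + Y t ω} :=
    measurableSet_lt hτ.measurable' (h.measurable_passageTime x)
  have hlaw := h.map_prodMk_restrict hτ x denseTime
  set A := {ω | τ ω < passageTime id fun t ↦ x + Y t ω} with hAdef
  have hσ : Measurable fun ω ↦ (τ ω).untopA := hτ.measurable'.untopA
  have hW : Measurable (stoppedValue (fun t ω ↦ (t, Y t ω)) τ) :=
    hσ.prodMk (h.measurable_comp hσ)
  have hm := h.measurable_increments hσ denseTime
  have hm' : Measurable fun ω i ↦ Y (denseTime i) ω :=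
    measurable_pi_lambda _ fun i ↦ h.measurable _
  have : IsProbabilityMeasure (P.map fun ω i ↦ Y (denseTime i) ω) :=
    Measure.isProbabilityMeasure_map hm'.aemeasurable
  have : IsFiniteMeasure ((P.restrict A).map (stoppedValue (fun t ω ↦ (t, Y t ω)) τ)) :=
    Measure.isFiniteMeasure_map _ _
  -- The discount at `ρ` as a measurable function of `(τ, Y_τ)` and of the later increments at dense
  -- times; it splits because `ρ` is `τ` plus the passage time of the shifted path.
  set H : (ℝ≥0 × ℝ) × (ℕ → ℝ) → ℝ := fun p ↦
    discount r p.1.1 * discount r (passageTime denseTime fun k ↦ (x + p.1.2) + p.2 k) with hH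
  have hHm : Measurable H := by
    have h1 : Measurable fun p : (ℝ≥0 × ℝ) × (ℕ → ℝ) ↦ fun k ↦ (x + p.1.2) + p.2 k := by fun_prop
    have h2 : Measurable fun p : (ℝ≥0 × ℝ) × (ℕ → ℝ) ↦ (p.1.1 : WithTop ℝ≥0) :=
      measurable_fst.fst.withTop_coe
    exact ((measurable_discount r).comp h2).mul
      ((measurable_discount r).comp (DefaultSwap.measurable_passageTime.comp h1))
  have hHb : ∀ p, ‖H p‖ ≤ 1 := fun p ↦ by
    rw [hH, Real.norm_eq_abs, abs_mul]
    exact mul_le_one₀ (abs_discount_le_one hr _) (abs_nonneg _) (abs_discount_le_one hr _)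
  calc _ = ∫ ω in A, H (stoppedValue (fun t ω ↦ (t, Y t ω)) τ ω,
          fun i ↦ Y ((τ ω).untopA + denseTime i) ω - Y (τ ω).untopA ω) ∂P := by
        refine setIntegral_congr_fun hA fun ω hω ↦ ?_
        obtain ⟨s, hs⟩ := WithTop.ne_top_iff_exists.1
          (show τ ω < passageTime id fun t ↦ x + Y t ω from hω).ne_top
        have hω' : (s : WithTop ℝ≥0) < passageTime id fun t ↦ x + Y t ω := hs ▸ hω
        simp only [hH, stoppedValue, ← hs]
        change _ = discount r s * discount r (passageTime denseTime fun k ↦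
          (x + Y s ω) + (Y (s + denseTime k) ω - Y s ω))
        simp only [add_add_sub_cancel]
        have hrc : ∀ t, ContinuousWithinAt (fun t ↦ x + Y (s + t) ω) (Set.Ici t) t := fun t ↦
          ContinuousWithinAt.comp (f := fun t ↦ s + t) (t := Set.Ici (s + t))
            (h.rightContinuous_const_add x ω (s + t))
            (continuous_const.add continuous_id).continuousWithinAt
            fun u hu ↦ add_le_add_right hu s
        rw [passageTime_denseTime hrc, passageTime_shift hω', discount_add, discount_coe]
    _ = ∫ p, H p ∂(((P.restrict A).map (stoppedValue (fun t ω ↦ (t, Y t ω)) τ)).prod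
          (P.map fun ω i ↦ Y (denseTime i) ω)) := by
        rw [← hlaw, integral_map (hW.prodMk hm).aemeasurable hHm.aestronglyMeasurable]
    _ = ∫ w, ∫ g, H (w, g) ∂(P.map fun ω i ↦ Y (denseTime i) ω)
          ∂((P.restrict A).map (stoppedValue (fun t ω ↦ (t, Y t ω)) τ)) :=
        integral_prod _ (Integrable.of_bound hHm.aestronglyMeasurable 1 (Eventually.of_forall hHb))
    _ = ∫ ω in A, ∫ g, H (stoppedValue (fun t ω ↦ (t, Y t ω)) τ ω, g)
          ∂(P.map fun ω i ↦ Y (denseTime i) ω) ∂P :=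
        integral_map hW.aemeasurable
          hHm.stronglyMeasurable.integral_prod_right.aestronglyMeasurable
    _ = _ := by
        refine setIntegral_congr_fun hA fun ω hω ↦ ?_
        obtain ⟨s, hs⟩ := WithTop.ne_top_iff_exists.1
          (show τ ω < passageTime id fun t ↦ x + Y t ω from hω).ne_top
        rw [integral_map (f := fun g ↦ H (stoppedValue (fun t ω ↦ (t, Y t ω)) τ ω, g))
          hm'.aemeasurable (hHm.comp measurable_prodMk_left).aestronglyMeasurable,
          ← integral_const_mul]
        refine integral_congr_ae (Eventually.of_forall fun ω' ↦ ?_)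
        simp only [hH, stoppedValue, ← hs]
        rw [passageTime_denseTime (f := fun t ↦ x + Y _ ω + Y t ω')
          (h.rightContinuous_const_add _ ω')]
        rfl

end IsMarkovLevy

end

/-! ### Default times and swap payoffs of a Lévy process -/

variable {Ω : Type*} {m : MeasurableSpace Ω} {P : Measure Ω} {X : ℝ≥0 → Ω → ℝ}

/-- The value `E^y[exp (-r θ)]` of a unit payment at the default time. -/
def defaultDiscount (P : Measure Ω) (X : ℝ≥0 → Ω → ℝ) (r y : ℝ) : ℝ :=
  ∫ ω, discount r (defaultTime X y ω) ∂P

lemma defaultTime_mono (X : ℝ≥0 → Ω → ℝ) (ω : Ω) : Monotone fun y ↦ defaultTime X y ω := by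
  intro y z hyz
  refine le_of_forall_gt fun c hc ↦ ?_
  obtain ⟨d, hd, hdc⟩ := exists_between hc
  lift d to ℝ≥0 using hdc.ne_top
  obtain ⟨j, hj, hj'⟩ := hittingAfter_lt_iff.1 hd
  refine lt_trans (hittingAfter_lt_iff.2 ⟨j, hj, ?_⟩) hdc
  simp only [Set.mem_Iic] at hj' ⊢
  linarith

lemma cdsPayoff_eq {r : ℝ} (hr : 0 < r) (X : ℝ≥0 → Ω → ℝ) (y κ a : ℝ) (ω : Ω) :
    cdsPayoff X r y κ a ω = -κ / r + (κ / r + a) * discount r (defaultTime X y ω) := by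
  rw [cdsPayoff, premiumLeg_eq hr κ zero_le, discount_zero]
  ring

/-- Before the default time, the callable swap exceeds the default swap that is never switched by the
discounted cash flows of the difference of the two swaps. -/
lemma callablePayoff_eq {r : ℝ} (hr : 0 < r) (X : ℝ≥0 → Ω → ℝ) (x p p' α α' γ : ℝ)
    {τ : Ω → WithTop ℝ≥0} {ω : Ω} (h : τ ω ≤ defaultTime X x ω) :
    callablePayoff X r x p p' α α' γ τ ω = cdsPayoff X r x p α ω +
      {ω | τ ω < defaultTime X x ω}.indicator (fun ω ↦ ((p - p') / r - γ) * discount r (τ ω) +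
        (-(p - p') / r - (α - α')) * discount r (defaultTime X x ω)) ω := by
  rw [callablePayoff, cdsPayoff_eq hr, premiumLeg_eq hr p zero_le, premiumLeg_eq hr p' h,
    discount_zero]
  rcases h.lt_or_eq with hlt | heq
  · rw [Set.indicator_of_mem (show ω ∈ {ω | τ ω < defaultTime X x ω} from hlt),
      if_pos (hlt.trans_le le_top), if_pos hlt, if_neg hlt.ne]
    ring
  · have hnot : ω ∉ {ω | τ ω < defaultTime X x ω} := heq.not_lt
    rw [Set.indicator_of_notMem hnot, ← heq]
    by_cases htop : τ ω < ⊤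
    · rw [if_pos htop, if_neg (lt_irrefl _), if_pos rfl]
      ring
    -- Here `τ` and the default time are both infinite, so the default payment is discounted to `0`.
    · rw [if_neg htop, not_lt_top_iff.1 htop, discount_top]
      ring

lemma integrable_discount [IsProbabilityMeasure P] {r : ℝ} {τ : Ω → WithTop ℝ≥0}
    (hr : 0 < r) (hτ : Measurable τ) :
    Integrable (fun ω ↦ discount r (τ ω)) P :=
  Integrable.of_bound ((measurable_discount r).comp hτ).aestronglyMeasurable 1
    (Eventually.of_forall fun _ ↦ abs_discount_le_one hr _)

lemma abs_defaultDiscount_le_one [IsProbabilityMeasure P] {r : ℝ} (hr : 0 < r) (y : ℝ) :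
    |defaultDiscount P X r y| ≤ 1 := by
  have h := norm_integral_le_of_norm_le_const (μ := P) (C := 1)
    (f := fun ω ↦ discount r (defaultTime X y ω))
    (Eventually.of_forall fun ω ↦ abs_discount_le_one hr (defaultTime X y ω))
  simpa [defaultDiscount] using h

lemma ae_callablePayoff_eq {r : ℝ} (hr : 0 < r) {x : ℝ} (p p' α α' γ : ℝ)
    {τ : Ω → WithTop ℝ≥0}     (hle : ∀ᵐ ω ∂P, τ ω ≤ defaultTime X x ω) :
    callablePayoff X r x p p' α α' γ τ =ᵐ[P] fun ω ↦ cdsPayoff X r x p α ω +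
      {ω | τ ω < defaultTime X x ω}.indicator (fun ω ↦ ((p - p') / r - γ) * discount r (τ ω) +
        (-(p - p') / r - (α - α')) * discount r (defaultTime X x ω)) ω :=
  hle.mono fun _ hω ↦ callablePayoff_eq hr X x p p' α α' γ hω

lemma swaptionPayoff_eq_indicator (P : Measure Ω) (X : ℝ≥0 → Ω → ℝ) (r x κ a K : ℝ)
    (τ : Ω → WithTop ℝ≥0) :
    swaptionPayoff P X r x κ a K τ = {ω | τ ω < defaultTime X x ω}.indicator fun ω ↦
      discount r (τ ω) *
        max (cdsValue P X r (stoppedValue (fun t ω ↦ x + X t ω) τ ω) κ a - K) 0 := by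
  ext ω
  by_cases h : τ ω < defaultTime X x ω
  · rw [swaptionPayoff, if_pos h, Set.indicator_of_mem
      (show ω ∈ {ω | τ ω < defaultTime X x ω} from h)]
  · rw [swaptionPayoff, if_neg h, Set.indicator_of_notMem
      (show ω ∉ {ω | τ ω < defaultTime X x ω} from h)]

/-- The discounted net value, at the exercise time `τ`, of entering the swap with premium `κ` and
default payment `a` for the strike `K`. -/
def netPayoff (P : Measure Ω) (X : ℝ≥0 → Ω → ℝ) (r x κ a K : ℝ) (τ : Ω → WithTop ℝ≥0) : Ω → ℝ :=
  {ω | τ ω < defaultTime X x ω}.indicator fun ω ↦ discount r (τ ω) *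
    (cdsValue P X r (stoppedValue (fun t ω ↦ x + X t ω) τ ω) κ a - K)

lemma netPayoff_le_swaptionPayoff (P : Measure Ω) (X : ℝ≥0 → Ω → ℝ) (r x κ a K : ℝ)
    (τ : Ω → WithTop ℝ≥0) (ω : Ω) :
    netPayoff P X r x κ a K τ ω ≤ swaptionPayoff P X r x κ a K τ ω := by
  rw [swaptionPayoff_eq_indicator, netPayoff]
  refine Set.indicator_le_indicator ?_
  exact mul_le_mul_of_nonneg_left (le_max_left _ _) (discount_nonneg r _)

/-! ### Transfer to the original process, integrability, and comparison of the two suprema -/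

namespace IsLevyProcess

lemma ae_stoppedValue_eq (hX : IsLevyProcess X P) (τ : Ω → WithTop ℝ≥0) (x : ℝ) :
    (fun ω ↦ x + stoppedValue (regularVersion X) τ ω) =ᵐ[P]
      stoppedValue (fun t ω ↦ x + X t ω) τ := by
  filter_upwards [hX.ae_regularVersion_eq] with ω hω
  exact congrArg (x + ·) (hω _)

variable [IsProbabilityMeasure P] [P.IsComplete] {r : ℝ} {τ : Ω → WithTop ℝ≥0}

lemma ae_defaultTime_eq (hX : IsLevyProcess X P) (y : ℝ) : ∀ᵐ ω ∂P,
    defaultTime X y ω = passageTime id fun t ↦ y + regularVersion X t ω := by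
  filter_upwards [hX.ae_regularVersion_eq,
    hX.isMarkovLevy_regularVersion.ae_hitTime_eq_passageTime y] with ω h1 h2
  rw [← h2]
  simp only [h1]
  rfl

/-- The default time is a stopping time of the completed filtration. -/
lemma isStoppingTime_defaultTime (hX : IsLevyProcess X P) (y : ℝ) :
    IsStoppingTime (generatedFiltration P X hX.measurable) (defaultTime X y) := by
  intro t
  have hM := hX.isMarkovLevy_regularVersion
  have h0 : MeasurableSet[generatedFiltration P X hX.measurable t]
      {ω | y + regularVersion X t ω ≤ 0} :=
    @measurableSet_le _ _ _ _ _ (generatedFiltration P X hX.measurable t) _ _ _ _ _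
      ((hM.adapted t).const_add y) measurable_const
  -- Almost surely, default by time `t` means passage before `t` or a nonpositive state at `t`;
  -- completeness of the filtration absorbs the null set.
  refine hX.measurableSet_congr ((hM.measurableSet_passageTime_lt y t).union h0) ?_
  filter_upwards [hX.ae_regularVersion_eq, hX.ae_defaultTime_eq y,
    hM.ae_hitTime_eq_passageTime y] with ω h1 h2 h3
  refine propext ?_
  change defaultTime X y ω ≤ t ↔ (passageTime id _ < _ ∨ y + regularVersion X t ω ≤ 0)
  rw [h2, ← h3]
  exact hitTime_le_iff (hM.rightContinuous_const_add y ω)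

lemma measurable_defaultTime (hX : IsLevyProcess X P) (y : ℝ) : Measurable (defaultTime X y) :=
  (hX.isStoppingTime_defaultTime y).measurable'

lemma integrable_cdsPayoff (hX : IsLevyProcess X P) (hr : 0 < r) (y κ a : ℝ) :
    Integrable (cdsPayoff X r y κ a) P := by
  simp_rw [funext (cdsPayoff_eq hr X y κ a)]
  exact (integrable_const _).add
    ((integrable_discount hr (hX.measurable_defaultTime y)).const_mul _)

lemma cdsValue_eq (hX : IsLevyProcess X P) (hr : 0 < r) (y κ a : ℝ) :
    cdsValue P X r y κ a = -κ / r + (κ / r + a) * defaultDiscount P X r y := by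
  rw [cdsValue, funext (cdsPayoff_eq hr X y κ a), integral_add (integrable_const _)
    ((integrable_discount hr (hX.measurable_defaultTime y)).const_mul _), integral_const_mul,
    defaultDiscount]
  simp

/-- A higher starting point delays default. Monotonicity is what makes `C(·; κ, a)` Borel
measurable. -/
lemma defaultDiscount_antitone (hX : IsLevyProcess X P) (hr : 0 < r) :
    Antitone (defaultDiscount P X r) := fun y z hyz ↦
  integral_mono (integrable_discount hr (hX.measurable_defaultTime z))
    (integrable_discount hr (hX.measurable_defaultTime y))
    fun ω ↦ discount_antitone hr (defaultTime_mono X ω hyz)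

lemma measurable_cdsValue (hX : IsLevyProcess X P) (hr : 0 < r) (κ a : ℝ) :
    Measurable fun y ↦ cdsValue P X r y κ a := by
  simp_rw [fun y ↦ hX.cdsValue_eq hr y κ a]
  exact ((hX.defaultDiscount_antitone hr).measurable.const_mul _).const_add _

lemma measurable_stoppedValue_regularVersion (hX : IsLevyProcess X P)
    (hτ : IsStoppingTime (generatedFiltration P X hX.measurable) τ) :
    Measurable[hτ.measurableSpace] (stoppedValue (regularVersion X) τ) :=
  measurable_stoppedValue (isStronglyProgressive_of_rightContinuous
    hX.isMarkovLevy_regularVersion.adapted hX.isMarkovLevy_regularVersion.rightContinuous) hτ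

lemma aemeasurable_stoppedValue (hX : IsLevyProcess X P)
    (hτ : IsStoppingTime (generatedFiltration P X hX.measurable) τ) (x : ℝ) :
    AEMeasurable (stoppedValue (fun t ω ↦ x + X t ω) τ) P :=
  (((hX.measurable_stoppedValue_regularVersion hτ).mono hτ.measurableSpace_le le_rfl).const_add
    x).aemeasurable.congr (hX.ae_stoppedValue_eq τ x)

/-- The strong Markov property for a unit payment at the default time. -/
lemma setIntegral_discount_defaultTime (hX : IsLevyProcess X P) (hr : 0 < r)
    (hτ : IsStoppingTime (generatedFiltration P X hX.measurable) τ) (x : ℝ) :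
    ∫ ω in {ω | τ ω < defaultTime X x ω}, discount r (defaultTime X x ω) ∂P =
      ∫ ω in {ω | τ ω < defaultTime X x ω}, discount r (τ ω) *
        defaultDiscount P X r (stoppedValue (fun t ω ↦ x + X t ω) τ ω) ∂P := by
  have hset : {ω | τ ω < defaultTime X x ω} =ᵐ[P]
      {ω | τ ω < passageTime id fun t ↦ x + regularVersion X t ω} := by
    filter_upwards [hX.ae_defaultTime_eq x] with ω hω
    exact congrArg (τ ω < ·) hω
  have hD : ∀ y, defaultDiscount P X r y =
      ∫ ω, discount r (passageTime id fun t ↦ y + regularVersion X t ω) ∂P := fun y ↦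
    integral_congr_ae ((hX.ae_defaultTime_eq y).mono fun ω hω ↦ congrArg (discount r) hω)
  rw [setIntegral_congr_set hset, setIntegral_congr_set hset]
  refine Eq.trans ?_ ((hX.isMarkovLevy_regularVersion.setIntegral_discount_passageTime
    hτ hr x).trans ?_)
  · exact integral_congr_ae (ae_restrict_of_ae
      ((hX.ae_defaultTime_eq x).mono fun ω hω ↦ congrArg (discount r) hω))
  · refine integral_congr_ae (ae_restrict_of_ae ?_)
    filter_upwards [hX.ae_stoppedValue_eq τ x] with ω hω
    rw [← hω, hD]

variable {x p p' α α' γ : ℝ}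

lemma measurableSet_lt_defaultTime (hX : IsLevyProcess X P)
    (hτ : IsStoppingTime (generatedFiltration P X hX.measurable) τ) (x : ℝ) :
    MeasurableSet {ω | τ ω < defaultTime X x ω} :=
  measurableSet_lt hτ.measurable' (hX.measurable_defaultTime x)

lemma integrable_callablePayoff (hX : IsLevyProcess X P) (hr : 0 < r)
    (hτ : τ ∈ exerciseTimes P X (generatedFiltration P X hX.measurable) x) :
    Integrable (callablePayoff X r x p p' α α' γ τ) P := by
  refine Integrable.congr ?_ (ae_callablePayoff_eq hr p p' α α' γ hτ.2).symm
  refine (hX.integrable_cdsPayoff hr x p α).add (Integrable.indicator ?_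
    (hX.measurableSet_lt_defaultTime hτ.1 x))
  exact ((integrable_discount hr hτ.1.measurable').const_mul _).add
    ((integrable_discount hr (hX.measurable_defaultTime x)).const_mul _)

lemma abs_cdsValue_le (hX : IsLevyProcess X P) (hr : 0 < r) (y κ a : ℝ) :
    |cdsValue P X r y κ a| ≤ |-κ / r| + |κ / r + a| := by
  rw [hX.cdsValue_eq hr]
  refine (abs_add_le _ _).trans ?_
  rw [abs_mul]
  gcongr
  exact mul_le_of_le_one_right (abs_nonneg _) (abs_defaultDiscount_le_one hr y)

lemma abs_swaptionPayoff_le (hX : IsLevyProcess X P) (hr : 0 < r) (x κ a K : ℝ)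
    (τ : Ω → WithTop ℝ≥0) (ω : Ω) :
    |swaptionPayoff P X r x κ a K τ ω| ≤ |-κ / r| + |κ / r + a| + |K| := by
  rw [swaptionPayoff]
  split_ifs
  · rw [abs_mul]
    refine (mul_le_of_le_one_left (abs_nonneg _) (abs_discount_le_one hr _)).trans ?_
    refine (abs_max_le_max_abs_abs).trans (max_le ?_ (by rw [abs_zero]; positivity))
    refine (abs_sub _ _).trans ?_
    gcongr
    exact hX.abs_cdsValue_le hr _ κ a
  · rw [abs_zero]
    positivity

lemma aemeasurable_cdsValue_stoppedValue (hX : IsLevyProcess X P) (hr : 0 < r)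
    (hτ : IsStoppingTime (generatedFiltration P X hX.measurable) τ) (x κ a : ℝ) :
    AEMeasurable (fun ω ↦ cdsValue P X r (stoppedValue (fun t ω ↦ x + X t ω) τ ω) κ a) P :=
  (hX.measurable_cdsValue hr κ a).comp_aemeasurable (hX.aemeasurable_stoppedValue hτ x)

lemma integrable_swaptionPayoff (hX : IsLevyProcess X P) (hr : 0 < r)
    (hτ : IsStoppingTime (generatedFiltration P X hX.measurable) τ) (x κ a K : ℝ) :
    Integrable (swaptionPayoff P X r x κ a K τ) P := by
  refine Integrable.of_bound ?_ _ (Eventually.of_forall (hX.abs_swaptionPayoff_le hr x κ a K τ))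
  rw [swaptionPayoff_eq_indicator]
  refine AEStronglyMeasurable.indicator ?_ (hX.measurableSet_lt_defaultTime hτ x)
  refine AEMeasurable.aestronglyMeasurable ?_
  exact ((measurable_discount r).comp hτ.measurable').aemeasurable.mul
    (((hX.aemeasurable_cdsValue_stoppedValue hr hτ x κ a).sub_const K).max aemeasurable_const)

lemma integrable_netPayoff (hX : IsLevyProcess X P) (hr : 0 < r)
    (hτ : IsStoppingTime (generatedFiltration P X hX.measurable) τ) (x κ a K : ℝ) :
    Integrable (netPayoff P X r x κ a K τ) P := by
  refine Integrable.indicator ?_ (hX.measurableSet_lt_defaultTime hτ x)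
  refine Integrable.of_bound (C := |-κ / r| + |κ / r + a| + |K|) ?_
    (Eventually.of_forall fun ω ↦ ?_)
  · exact (((measurable_discount r).comp hτ.measurable').aemeasurable.mul
      ((hX.aemeasurable_cdsValue_stoppedValue hr hτ x κ a).sub_const K)).aestronglyMeasurable
  · rw [Real.norm_eq_abs, abs_mul]
    refine (mul_le_of_le_one_left (abs_nonneg _) (abs_discount_le_one hr _)).trans ?_
    refine (abs_sub _ _).trans ?_
    gcongr
    exact hX.abs_cdsValue_le hr _ κ a

/-- The callable swap is the sum of the swap that is never switched and of the net value of the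
switch. -/
lemma integral_callablePayoff (hX : IsLevyProcess X P) (hr : 0 < r)
    (hτ : τ ∈ exerciseTimes P X (generatedFiltration P X hX.measurable) x) :
    ∫ ω, callablePayoff X r x p p' α α' γ τ ω ∂P =
      cdsValue P X r x p α + ∫ ω, netPayoff P X r x (-(p - p')) (-(α - α')) γ τ ω ∂P := by
  have hA := hX.measurableSet_lt_defaultTime hτ.1 x
  have hi1 : Integrable (fun ω ↦ discount r (τ ω)) P := integrable_discount hr hτ.1.measurable'
  have hi2 := integrable_discount (P := P) hr (hX.measurable_defaultTime x)
  have hi3 : Integrable (fun ω ↦ discount r (τ ω) *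
      defaultDiscount P X r (stoppedValue (fun t ω ↦ x + X t ω) τ ω)) P := by
    refine hi1.mul_bdd (c := 1) ?_ (Eventually.of_forall fun ω ↦ abs_defaultDiscount_le_one hr _)
    exact ((hX.defaultDiscount_antitone hr).measurable.comp_aemeasurable
      (hX.aemeasurable_stoppedValue hτ.1 x)).aestronglyMeasurable
  have hi4 : Integrable (fun ω ↦ ((p - p') / r - γ) * discount r (τ ω) +
      (-(p - p') / r - (α - α')) * discount r (defaultTime X x ω)) P :=
    (hi1.const_mul _).add (hi2.const_mul _)
  rw [integral_congr_ae (ae_callablePayoff_eq hr p p' α α' γ hτ.2), integral_add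
    (hX.integrable_cdsPayoff hr x p α) (hi4.indicator hA), cdsValue, integral_indicator hA,
    integral_add (hi1.const_mul _).integrableOn
    (hi2.const_mul _).integrableOn, integral_const_mul, integral_const_mul,
    hX.setIntegral_discount_defaultTime hr hτ.1 x, netPayoff, integral_indicator hA]
  congr 1
  rw [← integral_const_mul, ← integral_const_mul, ← integral_add (hi1.const_mul _).integrableOn
    (hi3.const_mul _).integrableOn]
  -- With `κ = -(p - p')` and `a = -(α - α')`, the coefficients `-κ/r` and `κ/r + a` are those of
  -- the combination on the left.
  refine integral_congr_ae (Eventually.of_forall fun ω ↦ ?_)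
  simp only [hX.cdsValue_eq hr]
  ring

lemma defaultTime_mem_exerciseTimes (hX : IsLevyProcess X P) (x : ℝ) :
    defaultTime X x ∈ exerciseTimes P X (generatedFiltration P X hX.measurable) x :=
  ⟨hX.isStoppingTime_defaultTime x, Eventually.of_forall fun _ ↦ le_rfl⟩

/-- Exercising only where the swap is worth more than the strike, and waiting for default otherwise,
gives a net value equal to the swaption payoff. -/
lemma exists_integral_netPayoff_eq (hX : IsLevyProcess X P) (hr : 0 < r) (κ a K : ℝ)
    (hτ : τ ∈ exerciseTimes P X (generatedFiltration P X hX.measurable) x) :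
    ∃ σ ∈ exerciseTimes P X (generatedFiltration P X hX.measurable) x,
      ∫ ω, netPayoff P X r x κ a K σ ω ∂P = ∫ ω, swaptionPayoff P X r x κ a K τ ω ∂P := by
  classical
  -- Using the regular version makes `A` an event of the σ-algebra at `τ`. Where the value equals
  -- `K`, both choices pay `0`.
  set A : Set Ω := {ω | K < cdsValue P X r (x + stoppedValue (regularVersion X) τ ω) κ a} with hA
  have hAm : MeasurableSet[hτ.1.measurableSpace] A :=
    ((hX.measurable_cdsValue hr κ a).comp
      (measurable_const_add x)).comp (hX.measurable_stoppedValue_regularVersion hτ.1)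
      (measurableSet_Ioi (a := K))
  refine ⟨A.piecewise τ (defaultTime X x), ⟨fun t ↦ ?_, ?_⟩, integral_congr_ae ?_⟩
  -- The event of default by `t` need not be cut down to the complement of `A`, because almost
  -- surely `τ` has then occurred too.
  · refine hX.measurableSet_congr ((((hτ.1.measurableSet _).1 hAm).2 t).union
      (hX.isStoppingTime_defaultTime x t)) ?_
    filter_upwards [hτ.2] with ω hω
    refine propext ?_
    change A.piecewise τ (defaultTime X x) ω ≤ t ↔
      (ω ∈ A ∧ τ ω ≤ t) ∨ defaultTime X x ω ≤ t
    by_cases h : ω ∈ A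
    · rw [Set.piecewise_eq_of_mem _ _ _ h]
      exact ⟨fun h' ↦ Or.inl ⟨h, h'⟩, fun h' ↦ h'.elim And.right hω.trans⟩
    · rw [Set.piecewise_eq_of_notMem _ _ _ h]
      exact ⟨Or.inr, fun h' ↦ h'.elim (fun h'' ↦ absurd h''.1 h) id⟩
  · filter_upwards [hτ.2] with ω hω
    by_cases h : ω ∈ A
    · rwa [Set.piecewise_eq_of_mem _ _ _ h]
    · rw [Set.piecewise_eq_of_notMem _ _ _ h]
  · filter_upwards [hX.ae_stoppedValue_eq τ x] with ω hω
    have hiff : ω ∈ A ↔ K < cdsValue P X r (stoppedValue (fun t ω ↦ x + X t ω) τ ω) κ a := by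
      rw [← hω]
      rfl
    rw [swaptionPayoff_eq_indicator, netPayoff]
    simp only [Set.indicator_apply, Set.mem_ofPred_eq, stoppedValue] at hiff ⊢
    by_cases h : ω ∈ A
    · simp only [Set.piecewise_eq_of_mem _ _ _ h]
      rw [max_eq_left (sub_nonneg.2 (hiff.1 h).le)]
    · simp only [Set.piecewise_eq_of_notMem _ _ _ h]
      rw [if_neg (lt_irrefl _),
        max_eq_right (sub_nonpos.2 (not_lt.1 (mt hiff.2 h))), mul_zero, ite_self]

/-- `C` is bounded uniformly in the starting point, since `D` lies in `[-1, 1]`. -/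
lemma bddAbove_swaptionExpectations (hX : IsLevyProcess X P) (hr : 0 < r) (x κ a K : ℝ) :
    BddAbove (swaptionExpectations P X (generatedFiltration P X hX.measurable) r x κ a K) := by
  refine ⟨|-κ / r| + |κ / r + a| + |K|, ?_⟩
  rintro _ ⟨τ, -, rfl⟩
  have h := norm_integral_le_of_norm_le_const (μ := P) (f := swaptionPayoff P X r x κ a K τ)
    (Eventually.of_forall (hX.abs_swaptionPayoff_le hr x κ a K τ))
  rw [probReal_univ, mul_one] at h
  exact (le_abs_self _).trans h

/-- The callable swap is worth at most the swap that is never switched plus the swaption. -/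
lemma integral_callablePayoff_le (hX : IsLevyProcess X P) (hr : 0 < r)
    (hτ : τ ∈ exerciseTimes P X (generatedFiltration P X hX.measurable) x) :
    ∫ ω, callablePayoff X r x p p' α α' γ τ ω ∂P ≤ cdsValue P X r x p α +
      swaptionValue P X (generatedFiltration P X hX.measurable) r x (-(p - p')) (-(α - α')) γ := by
  rw [hX.integral_callablePayoff hr hτ]
  gcongr
  refine (integral_mono (hX.integrable_netPayoff hr hτ.1 _ _ _ _)
    (hX.integrable_swaptionPayoff hr hτ.1 _ _ _ _) (netPayoff_le_swaptionPayoff P X r _ _ _ _ τ)).trans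
    (le_csSup (hX.bddAbove_swaptionExpectations hr _ _ _ _) ⟨τ, hτ, rfl⟩)

lemma bddAbove_callableExpectations (hX : IsLevyProcess X P) (hr : 0 < r) (x p p' α α' γ : ℝ) :
    BddAbove (callableExpectations P X (generatedFiltration P X hX.measurable) r x p p' α α' γ) := by
  refine ⟨cdsValue P X r x p α + swaptionValue P X (generatedFiltration P X hX.measurable) r x
    (-(p - p')) (-(α - α')) γ, ?_⟩
  rintro _ ⟨τ, hτ, rfl⟩
  exact hX.integral_callablePayoff_le hr hτ

lemma callableValue_eq (hX : IsLevyProcess X P) (hr : 0 < r) (x p p' α α' γ : ℝ) :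
    callableValue P X (generatedFiltration P X hX.measurable) r x p p' α α' γ =
      cdsValue P X r x p α +
        swaptionValue P X (generatedFiltration P X hX.measurable) r x
          (-(p - p')) (-(α - α')) γ := by
  refine le_antisymm (csSup_le ⟨_, _, hX.defaultTime_mem_exerciseTimes x, rfl⟩ ?_) ?_
  · rintro _ ⟨τ, hτ, rfl⟩
    exact hX.integral_callablePayoff_le hr hτ
  · rw [← le_sub_iff_add_le']
    refine csSup_le ⟨_, _, hX.defaultTime_mem_exerciseTimes x, rfl⟩ ?_
    rintro _ ⟨τ, hτ, rfl⟩
    -- Exercising the callable swap at `σ` attains the never-switched value plus the swaption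
    -- expectation at `τ`.
    obtain ⟨σ, hσ, heq⟩ := hX.exists_integral_netPayoff_eq hr (-(p - p')) (-(α - α')) γ hτ
    rw [le_sub_iff_add_le']
    simp only
    rw [← heq, ← hX.integral_callablePayoff hr hσ]
    exact le_csSup (hX.bddAbove_callableExpectations hr x p p' α α' γ) ⟨σ, hσ, rfl⟩

end IsLevyProcess

end DefaultSwap

end

theorem mainTheorem3 {Ω : Type*} {m : MeasurableSpace Ω}
    (P : Measure Ω) [IsProbabilityMeasure P] [P.IsComplete]
    (X : ℝ≥0 → Ω → ℝ) (hX : DefaultSwap.IsLevyProcess X P)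
    (r : ℝ) (hr : 0 < r)
    (p p' α α' γ : ℝ) (hp : 0 ≤ p) (hp' : 0 ≤ p') (hα : 0 ≤ α) (hα' : 0 ≤ α') (hγ : 0 ≤ γ)
    (x : ℝ) :
    -- all the expectations exist
    (∀ y κ a : ℝ, Integrable (DefaultSwap.cdsPayoff X r y κ a) P) ∧
    (∀ τ ∈ DefaultSwap.exerciseTimes P X
        (DefaultSwap.generatedFiltration P X hX.measurable) x,
      Integrable (DefaultSwap.callablePayoff X r x p p' α α' γ τ) P ∧
      Integrable (DefaultSwap.swaptionPayoff P X r x (-(p - p')) (-(α - α')) γ τ) P) ∧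
    -- both suprema are finite
    BddAbove (DefaultSwap.callableExpectations P X
      (DefaultSwap.generatedFiltration P X hX.measurable) r x p p' α α' γ) ∧
    BddAbove (DefaultSwap.swaptionExpectations P X
      (DefaultSwap.generatedFiltration P X hX.measurable) r x (-(p - p')) (-(α - α')) γ) ∧
    -- the decomposition
    DefaultSwap.callableValue P X
        (DefaultSwap.generatedFiltration P X hX.measurable) r x p p' α α' γ =
      DefaultSwap.cdsValue P X r x p α +
        DefaultSwap.swaptionValue P X
          (DefaultSwap.generatedFiltration P X hX.measurable) r x
          (-(p - p')) (-(α - α')) γ :=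
  ⟨fun y κ a ↦ hX.integrable_cdsPayoff hr y κ a,
    fun _ hτ ↦ ⟨hX.integrable_callablePayoff hr hτ, hX.integrable_swaptionPayoff hr hτ.1 _ _ _ _⟩,
    hX.bddAbove_callableExpectations hr x p p' α α' γ,
    hX.bddAbove_swaptionExpectations hr x _ _ _, hX.callableValue_eq hr x p p' α α' γ⟩
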